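/- Let $n \ge 0$ and $[n] = \{1,\dots,n\}$. Consider the following three families. (a) The intersection closed collections of subintervals of $[n]$, i.e. the subsets $X$ of $\{(a,b) : 1 \le a \le b \le n\}$ such that $(a,c) \in X$ and $(b,d) \in X$ imply $(b,c) \in X$ for all $1 \le a \le b \le c \le d \le n$. (b) The union closed collections of subintervals of $[n]$, i.e. the subsets $X$ of $\{(a,b) : 1 \le a \le b \le n\}$ such that $(a,c) \in X$ and $(b,d) \in X$ imply $(a,d) \in X$ for all $1 \le a \le b \le c \le d \le n$. (c) The Yoshi permutations of $[2n]$, i.e. the permutations $\sigma$ of $[2n]$ such that $\sigma(i) \le 2i$ and $\sigma(2n-i+1) \ge 2(n-i)+1$ for all $i \in [n]$. Yoshi Hill is the triangular network formed by $n$ uphill streets and $n$ downhill avenues, where the $a$th street meets the $b$th avenue if and only if $a \le b$, at a point $(a,b)$ of abscissa $a+b$ and height $b-a$. For a subset $X$ of these intersections, put an elbow at each $(a,b) \in X$ and a crossing at each other intersection. This gives $2n$ pipes which run down from $2n$ faucets to $2n$ customers, both numbered from left to right. At the intersection $(a,b)$, the pipes in positions $a+b-1$ and $a+b$ from the left meet;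 they exchange their positions if there is a crossing, and keep them if there is an elbow. Let $\sigma_X$ be the permutation of $[2n]$ such that the pipe from the $i$th faucet reaches the $\sigma_X(i)$th customer. Then $X \mapsto \sigma_X$ restricts to a bijection from (a) to (c) and to a bijection from (b) to (c), hence there is a bijection $X \mapsto Y$ from (a) to (b) such that $\sigma_X = \sigma_Y$. These bijections are size preserving: $|X| = \binom{n+1}{2} - \operatorname{inv}(\sigma_X)$ for every $X$ in (a) or in (b), where $\operatorname{inv}$ is the number of inversions, and $|X| = |Y|$ whenever $Y$ in (b) corresponds to $X$ in (a). Moreover, let $\tau = \sigma_\varnothing$ be the permutation obtained when all intersections are crossings. A permutation $\sigma$ of $[2n]$ is a Yoshi permutation if and only if $\sigma \le \tau$ in the strong Bruhat order, i.e. some reduced expression of $\sigma$ is a subword of some reduced expression of $\tau$. -/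

import Mathlib

namespace YoshiHill

/-- A subset `X` of `{(a, b) | 1 ≤ a ≤ b ≤ n}`; the pair `(a, b)` stands for the interval `[a, b]`.
Indices are shifted by one: the element `a : Fin n` stands for the integer `a + 1` of `[n]`. -/
def IsIntervalCollection {n : ℕ} (X : Finset (Fin n × Fin n)) : Prop :=
  ∀ p ∈ X, p.1 ≤ p.2

/-- Intersection closed collections of subintervals of `[n]`. -/
def IntersectionClosed {n : ℕ} (X : Finset (Fin n × Fin n)) : Prop :=
  IsIntervalCollection X ∧
    ∀ a b c d : Fin n, a ≤ b → b ≤ c → c ≤ d → (a, c) ∈ X → (b, d) ∈ X → (b, c) ∈ X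

/-- Union closed collections of subintervals of `[n]`. -/
def UnionClosed {n : ℕ} (X : Finset (Fin n × Fin n)) : Prop :=
  IsIntervalCollection X ∧
    ∀ a b c d : Fin n, a ≤ b → b ≤ c → c ≤ d → (a, c) ∈ X → (b, d) ∈ X → (a, d) ∈ X

/-- Yoshi permutations of `[2n]`: `σ(i) ≤ 2i` and `σ(2n - i + 1) ≥ 2(n - i) + 1` for `i ∈ [n]`.
Here `k : Fin n` stands for `i = k + 1`, an element `x : Fin (2 * n)` stands for `x + 1 ∈ [2n]`,
and `Fin.rev` is the reflection `i ↦ 2n - i + 1` of `[2n]`. -/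
def IsYoshi {n : ℕ} (σ : Equiv.Perm (Fin (2 * n))) : Prop :=
  ∀ k : Fin n,
    ((σ ⟨k, by omega⟩ : Fin (2 * n)) : ℕ) + 1 ≤ 2 * ((k : ℕ) + 1) ∧
    2 * (n - ((k : ℕ) + 1)) + 1 ≤ ((σ (Fin.rev ⟨k, by omega⟩) : Fin (2 * n)) : ℕ) + 1

/-- The inversion number (Coxeter length) of a permutation of `[m]`. -/
def inv {m : ℕ} (σ : Equiv.Perm (Fin m)) : ℕ :=
  (Finset.univ.filter fun p : Fin m × Fin m => p.1 < p.2 ∧ σ p.2 < σ p.1).card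

/-- The intersections `(a, b)`, `a ≤ b`, of the `a`th uphill street with the `b`th downhill avenue.
The intersection `(a, b)` sits at abscissa `a + b` and height `b - a`. Streets are listed from left
to right, and each one from top to bottom, so that every intersection is listed after all those
from which water can reach it. -/
def intersections (n : ℕ) : List (Fin n × Fin n) :=
  (List.finRange n).flatMap fun a =>
    (((List.finRange n).filter fun b => a ≤ b).reverse).map fun b => (a, b)

/-- The effect of the intersection `p = (a, b)` on the `2n` pipes, numbered by their current
position from left to right. The pipes that meet there are in positions `a + b - 1` and `a + b`
(counting from one). They exchange their positions at a crossing, and keep them at an elbow. -/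
def gate {n : ℕ} (X : Finset (Fin n × Fin n)) (p : Fin n × Fin n) :
    Equiv.Perm (Fin (2 * n)) :=
  if p ∈ X then 1
  else Equiv.swap ⟨(p.1 : ℕ) + p.2, by omega⟩ ⟨(p.1 : ℕ) + p.2 + 1, by omega⟩

/-- The bill assignment of the pipe configuration with elbows at `X` and crossings at all the other
intersections: the water of the `i`th faucet (faucets are on the top path, numbered from left to
right) goes down to the customer `plumbing X i` (on the bottom path, numbered from left to
right). In the product, the first intersections of the list act first. -/
def plumbing {n : ℕ} (X : Finset (Fin n × Fin n)) : Equiv.Perm (Fin (2 * n)) :=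
  (((intersections n).map (gate X)).reverse).prod

/-- `w` is a word on the simple transpositions `(i i+1)` of `[m]`. -/
def IsSimpleWord {m : ℕ} (w : List (Equiv.Perm (Fin m))) : Prop :=
  ∀ s ∈ w, ∃ i j : Fin m, (i : ℕ) + 1 = j ∧ s = Equiv.swap i j

/-- `w` is a reduced expression of `σ`: a word on simple transpositions with product `σ`, of
minimal length among all those words. -/
def IsReducedExpression {m : ℕ} (w : List (Equiv.Perm (Fin m))) (σ : Equiv.Perm (Fin m)) : Prop :=
  IsSimpleWord w ∧ w.prod = σ ∧
    ∀ w' : List (Equiv.Perm (Fin m)), IsSimpleWord w' → w'.prod = σ → w.length ≤ w'.length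

/-- The strong Bruhat order: `σ ≤ τ` if some reduced expression of `σ` is a subword of some reduced
expression of `τ`. -/
def BruhatLE {m : ℕ} (σ τ : Equiv.Perm (Fin m)) : Prop :=
  ∃ v w : List (Equiv.Perm (Fin m)),
    IsReducedExpression v σ ∧ IsReducedExpression w τ ∧ List.Sublist v w

end YoshiHill

/-!
The intersections are listed in an order in which water passes them, so that a collection `X` of
elbows selects a subword (the crossings) of a word on simple transpositions, and `σ_X` is the
product of this subword. Call the subword *distinguished* if, at every intersection, the two pipes
that arrive there are still in the order of their faucets. Distinguished subwords are reduced
(`Distinguished.inv_run`) and determined by their product (`Distinguished.mem_iff_of_run_eq`), and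
the strong exchange property shows that every product of a subword is the product of a distinguished
one (`exists_distinguished`).

*Closed collections are the distinguished subwords.* On a grid of streets and avenues, follow the
labels of the pipes along all the edges. The pipes that arrive at each intersection are in order if
and only if the elbows are union closed (`ClosedOn.ascent`, `GridLabels.closedOn`). The reason is
that the labels on two avenues get out of order exactly because of a street with an elbow before the
second avenue and a crossing at this avenue, and then closedness forbids the elbow on the second
avenue at which the two pipes would meet. A half-turn of Yoshi Hill replaces `σ_X` by the conjugate
of its inverse by the reflection of `[2n]`, and intersections by unions. The half-turned triangle is
completed to a square grid with elbows, which do nothing, and the same criterion on the grid then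
deals with the intersection closed collections (`unionClosed_iff_distinguished`,
`intersectionClosed_iff_distinguished`).

*Yoshi permutations are the products of subwords.* With crossings only, the pipe of each avenue and
the pipe of each street go straight, so that `τ` maps the `b`th faucet to `2b` and the `(n + a)`th one
to `2a - 1` (numbered from one). Hence `σ` is a Yoshi permutation if and only if `σ ≤ τ` on the first
half of `[2n]` and `σ ≥ τ` on the other half. This criterion for being the product of a subword
holds for all initial parts of the network, by induction on the number of intersections
(`halfLE_run_empty_iff`).

*The Bruhat order.* Distinguished subwords give a reduced expression of each Yoshi permutation inside
one of `τ`. Conversely, if `σ` is a subword of any reduced expression of `τ`, then `σ` inherits from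
`τ` all conditions of the form `σ [I] ⊆ [J]` (`MapsInitial.of_sublist`), and the Yoshi conditions for
`σ` are of this form for `σ` and for its inverse.
-/

namespace YoshiHill

/-! ### Inversions and adjacent transpositions -/

theorem inv_swap_mul {m : ℕ} {i j : Fin m} (hij : (i : ℕ) + 1 = j) {σ : Equiv.Perm (Fin m)}
    (h : σ.symm i < σ.symm j) : inv (Equiv.swap i j * σ) = inv σ + 1 := by
  unfold inv
  have hmem : (σ.symm i, σ.symm j) ∉
      Finset.univ.filter fun p : Fin m × Fin m => p.1 < p.2 ∧ σ p.2 < σ p.1 := by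
    simp only [Finset.mem_filter, Finset.mem_univ, true_and, Equiv.apply_symm_apply, not_and]
    intro _ hlt
    have : (j : ℕ) < i := hlt
    omega
  rw [← Finset.card_insert_of_notMem hmem]
  congr 1
  ext ⟨x, y⟩
  rw [Finset.mem_insert, Finset.mem_filter, Finset.mem_filter]
  simp only [Finset.mem_univ, true_and, Prod.mk.injEq, Equiv.Perm.mul_apply]
  obtain ⟨u, rfl⟩ := σ.symm.surjective x
  obtain ⟨v, rfl⟩ := σ.symm.surjective y
  simp only [Equiv.apply_symm_apply, EmbeddingLike.apply_eq_iff_eq]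
  have huv : σ.symm u < σ.symm v → u ≠ v := by rintro h rfl; exact lt_irrefl _ h
  have hji : ¬ (σ.symm u < σ.symm v ∧ u = j ∧ v = i) := by
    rintro ⟨h1, rfl, rfl⟩; exact lt_asymm h h1
  by_cases hlt : σ.symm u < σ.symm v
  · have h1 := huv hlt
    have h2 : ¬ (u = j ∧ v = i) := fun h' => hji ⟨hlt, h'⟩
    simp only [hlt, true_and]
    simp only [Equiv.swap_apply_def, Fin.ext_iff, Fin.lt_def] at *
    split_ifs <;> omega
  · have h3 : ¬ (u = i ∧ v = j) := by rintro ⟨rfl, rfl⟩; exact hlt h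
    simp [hlt, h3]

theorem inv_swap_mul_of_gt {m : ℕ} {i j : Fin m} (hij : (i : ℕ) + 1 = j) {σ : Equiv.Perm (Fin m)}
    (h : σ.symm j < σ.symm i) : inv (Equiv.swap i j * σ) + 1 = inv σ := by
  have := inv_swap_mul (σ := Equiv.swap i j * σ) hij (by
    have e : (Equiv.swap i j * σ).symm = σ.symm * Equiv.swap i j := by
      ext; simp [Equiv.Perm.mul_def]
    simpa [e] using h)
  rwa [← mul_assoc, Equiv.swap_mul_self, one_mul, eq_comm] at this

theorem inv_one {m : ℕ} : inv (1 : Equiv.Perm (Fin m)) = 0 := by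
  simp only [inv, Finset.card_eq_zero, Finset.filter_eq_empty_iff]
  rintro ⟨x, y⟩ - ⟨h1, h2⟩
  exact lt_asymm h1 h2

theorem inv_inv {m : ℕ} (σ : Equiv.Perm (Fin m)) : inv σ⁻¹ = inv σ := by
  refine Finset.card_bij' (fun p _ => (σ⁻¹ p.2, σ⁻¹ p.1)) (fun p _ => (σ p.2, σ p.1)) ?_ ?_ ?_ ?_ <;>
    simp +contextual

theorem inv_conj_rev {m : ℕ} (σ : Equiv.Perm (Fin m)) :
    inv (Fin.revPerm * σ * Fin.revPerm) = inv σ := by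
  refine Finset.card_bij' (fun p _ => (p.2.rev, p.1.rev)) (fun p _ => (p.2.rev, p.1.rev))
    ?_ ?_ ?_ ?_ <;> simp +contextual

/-! ### Subwords of a list of gates -/

/-- Left position of the two pipes that meet at the intersection `p`. -/
def lo {n : ℕ} (p : Fin n × Fin n) : Fin (2 * n) := ⟨(p.1 : ℕ) + p.2, by omega⟩

/-- Right position of the two pipes that meet at the intersection `p`. -/
def hi {n : ℕ} (p : Fin n × Fin n) : Fin (2 * n) := ⟨(p.1 : ℕ) + p.2 + 1, by omega⟩

theorem lo_add_one {n : ℕ} (p : Fin n × Fin n) : (lo p : ℕ) + 1 = hi p := rfl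

theorem lo_lt_hi {n : ℕ} (p : Fin n × Fin n) : lo p < hi p := Nat.lt_succ_self _

theorem gate_def {n : ℕ} (X : Finset (Fin n × Fin n)) (p : Fin n × Fin n) :
    gate X p = if p ∈ X then 1 else Equiv.swap (lo p) (hi p) := rfl

/-- The permutation produced by a list of intersections with elbows at `X` and crossings elsewhere.
The head of the list acts last. -/
def run {n : ℕ} (X : Finset (Fin n × Fin n)) (l : List (Fin n × Fin n)) :
    Equiv.Perm (Fin (2 * n)) :=
  (l.map (gate X)).prod

@[simp] theorem run_nil {n : ℕ} (X : Finset (Fin n × Fin n)) : run X [] = 1 := rfl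

@[simp] theorem run_cons {n : ℕ} (X : Finset (Fin n × Fin n)) (p : Fin n × Fin n)
    (l : List (Fin n × Fin n)) : run X (p :: l) = gate X p * run X l := by
  simp [run]

theorem plumbing_eq_run {n : ℕ} (X : Finset (Fin n × Fin n)) :
    plumbing X = run X (intersections n).reverse := by
  simp [plumbing, run, List.map_reverse]

theorem run_congr {n : ℕ} {X Y : Finset (Fin n × Fin n)} {l : List (Fin n × Fin n)}
    (h : ∀ p ∈ l, p ∈ X ↔ p ∈ Y) : run X l = run Y l := by
  unfold run
  congr 1
  refine List.map_congr_left fun p hp => ?_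
  simp [gate_def, h p hp]

/-- The elbow at one intersection outside of `l` can be chosen freely. -/
theorem exists_mem_iff {n : ℕ} (X : Finset (Fin n × Fin n)) {l : List (Fin n × Fin n)}
    {p : Fin n × Fin n} (hp : p ∉ l) (Q : Prop) :
    ∃ Y : Finset (Fin n × Fin n), (p ∈ Y ↔ Q) ∧ ∀ q ∈ l, q ∈ Y ↔ q ∈ X := by
  by_cases hQ : Q
  · refine ⟨insert p X, by simp [hQ], fun q hq => ?_⟩
    have : q ≠ p := fun h => hp (h ▸ hq)
    simp [this]
  · refine ⟨X.erase p, by simp [hQ], fun q hq => ?_⟩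
    have : q ≠ p := fun h => hp (h ▸ hq)
    simp [this]

/-- The two pipes that arrive at the positions of `p` after `σ` come from faucets in increasing
order. -/
def Ascent {n : ℕ} (σ : Equiv.Perm (Fin (2 * n))) (p : Fin n × Fin n) : Prop :=
  σ.symm (lo p) < σ.symm (hi p)

/-- The subword of `l` left by elbows at `X` is distinguished: two pipes that arrive at an
intersection, be it an elbow or a crossing, are still in the order of their faucets. -/
def Distinguished {n : ℕ} (X : Finset (Fin n × Fin n)) (l : List (Fin n × Fin n)) : Prop :=
  ∀ p l', p :: l' <:+ l → Ascent (run X l') p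

theorem distinguished_nil {n : ℕ} (X : Finset (Fin n × Fin n)) : Distinguished X [] := by
  intro p l' h
  simp at h

theorem distinguished_cons {n : ℕ} {X : Finset (Fin n × Fin n)} {p : Fin n × Fin n}
    {l : List (Fin n × Fin n)} :
    Distinguished X (p :: l) ↔ Ascent (run X l) p ∧ Distinguished X l := by
  constructor
  · intro h
    exact ⟨h p l List.suffix_rfl, fun q l' hq => h q l' (hq.trans (List.suffix_cons p l))⟩
  · rintro ⟨h1, h2⟩ q l' hq
    rcases List.suffix_cons_iff.1 hq with h | h
    · obtain ⟨rfl, rfl⟩ := List.cons.inj h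
      exact h1
    · exact h2 q l' h

theorem Distinguished.congr {n : ℕ} {X Y : Finset (Fin n × Fin n)} {l : List (Fin n × Fin n)}
    (hX : Distinguished X l) (h : ∀ p ∈ l, p ∈ X ↔ p ∈ Y) : Distinguished Y l := by
  intro p l' hp
  rw [← run_congr fun q hq => h q (hp.subset (List.mem_cons_of_mem p hq))]
  exact hX p l' hp

theorem ascent_swap_mul {n : ℕ} {σ : Equiv.Perm (Fin (2 * n))} {p : Fin n × Fin n} :
    Ascent (Equiv.swap (lo p) (hi p) * σ) p ↔ ¬ Ascent σ p := by
  have e : (Equiv.swap (lo p) (hi p) * σ).symm = σ.symm * Equiv.swap (lo p) (hi p) := by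
    ext; simp [Equiv.Perm.mul_def]
  have hne : σ.symm (lo p) ≠ σ.symm (hi p) := fun h =>
    (lo_lt_hi p).ne (σ.symm.injective h)
  simp only [Ascent, e, Equiv.Perm.mul_apply, Equiv.swap_apply_left, Equiv.swap_apply_right, not_lt]
  exact ⟨le_of_lt, fun h => lt_of_le_of_ne h hne.symm⟩

/-- A distinguished subword is reduced: its length is the number of inversions of its product. -/
theorem Distinguished.inv_run {n : ℕ} {X : Finset (Fin n × Fin n)} {l : List (Fin n × Fin n)}
    (h : Distinguished X l) : (l.filter (· ∈ X)).length + inv (run X l) = l.length := by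
  induction l with
  | nil => simp [inv_one]
  | cons p l ih =>
    obtain ⟨h1, h2⟩ := distinguished_cons.1 h
    have := ih h2
    by_cases hp : p ∈ X
    · simp [gate_def, hp]; omega
    · simp [gate_def, hp, inv_swap_mul (lo_add_one p) h1]; omega

/-- Distinguished subwords of a given list are determined by their products. -/
theorem Distinguished.mem_iff_of_run_eq {n : ℕ} {X Y : Finset (Fin n × Fin n)}
    {l : List (Fin n × Fin n)} (hX : Distinguished X l) (hY : Distinguished Y l)
    (h : run X l = run Y l) : ∀ p ∈ l, p ∈ X ↔ p ∈ Y := by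
  induction l with
  | nil => simp
  | cons p l ih =>
    obtain ⟨hX1, hX2⟩ := distinguished_cons.1 hX
    obtain ⟨hY1, hY2⟩ := distinguished_cons.1 hY
    have key : ∀ Z : Finset (Fin n × Fin n), Ascent (run Z l) p →
        (Ascent (run Z (p :: l)) p ↔ p ∈ Z) := by
      intro Z hZ
      by_cases hp : p ∈ Z
      · simp [gate_def, hp, hZ]
      · simp [gate_def, hp, ascent_swap_mul, hZ]
    have hp : p ∈ X ↔ p ∈ Y := by rw [← key X hX1, ← key Y hY1, h]
    have hg : gate X p = gate Y p := by simp [gate_def, hp]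
    rw [run_cons, run_cons, hg] at h
    intro q hq
    rcases List.mem_cons.1 hq with rfl | hq
    · exact hp
    · exact ih hX2 hY2 (mul_left_cancel h) q hq

/-- Strong exchange property: an inversion of the product of a subword can be undone by changing
the subword, since it was created by some letter. -/
theorem exchange {n : ℕ} {l : List (Fin n × Fin n)} (hl : l.Nodup) (X : Finset (Fin n × Fin n))
    {α β : Fin (2 * n)} (hαβ : α < β) (h : run X l β < run X l α) :
    ∃ Y, run Y l = run X l * Equiv.swap α β := by
  induction l with
  | nil => exact absurd h (by simpa using hαβ.le)
  | cons p l ih =>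
    obtain ⟨hp, hl⟩ := List.nodup_cons.1 hl
    rcases lt_trichotomy (run X l β) (run X l α) with h' | h' | h'
    · obtain ⟨Y', hY'⟩ := ih hl h'
      obtain ⟨Y, hYp, hY⟩ := exists_mem_iff Y' hp (p ∈ X)
      refine ⟨Y, ?_⟩
      have hg : gate Y p = gate X p := by simp [gate_def, hYp]
      rw [run_cons, run_cons, hg, run_congr hY, hY', mul_assoc]
    · exact absurd ((run X l).injective h') hαβ.ne'
    · -- The letter at `p` is the one that creates the inversion, so it is the letter to drop.
      obtain ⟨Y, hYp, hY⟩ := exists_mem_iff X hp True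
      refine ⟨Y, ?_⟩
      by_cases hpX : p ∈ X
      · simp [gate_def, hpX] at h
        exact absurd h h'.not_gt
      simp only [run_cons, gate_def, hpX, if_false, Equiv.Perm.mul_apply] at h
      have h1 : run X l α = lo p ∧ run X l β = hi p := by
        have := lo_add_one p
        simp only [Equiv.swap_apply_def, Fin.ext_iff, Fin.lt_def] at *
        split_ifs at h <;> omega
      have h2 : gate Y p = 1 := by simp [gate_def, hYp]
      rw [run_cons, run_cons, h2, run_congr hY, gate_def, if_neg hpX, ← h1.1, ← h1.2, one_mul,
        Equiv.swap_mul_eq_mul_swap, Equiv.Perm.coe_inv, Equiv.symm_apply_apply,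
        Equiv.symm_apply_apply, mul_assoc, Equiv.swap_mul_self, mul_one]

/-- Every product of a subword is the product of a distinguished one, found by sorting the labels
greedily from the last letter to the first. -/
theorem exists_distinguished {n : ℕ} {l : List (Fin n × Fin n)} (hl : l.Nodup)
    (X : Finset (Fin n × Fin n)) : ∃ Y, Distinguished Y l ∧ run Y l = run X l := by
  induction l generalizing X with
  | nil => exact ⟨X, distinguished_nil X, rfl⟩
  | cons p l ih =>
    obtain ⟨hp, hl⟩ := List.nodup_cons.1 hl
    -- Among `run X l` and its product with the transposition at `p`, one has an ascent at `p`.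
    obtain ⟨Z, hZ, Q, hQ⟩ : ∃ Z, Ascent (run Z l) p ∧ ∃ Q : Prop,
        (Q → run X (p :: l) = run Z l) ∧
        (¬ Q → run X (p :: l) = Equiv.swap (lo p) (hi p) * run Z l) := by
      by_cases ha : Ascent (run X l) p
      · refine ⟨X, ha, p ∈ X, ?_, ?_⟩ <;> intro h <;> simp [gate_def, h]
      · have hlt : (run X l).symm (hi p) < (run X l).symm (lo p) :=
          lt_of_le_of_ne (not_lt.1 ha) fun h => (lo_lt_hi p).ne' ((run X l).symm.injective h)
        obtain ⟨Z, hZ⟩ := exchange hl X hlt (by simpa using lo_lt_hi p)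
        have hZ' : run Z l = Equiv.swap (lo p) (hi p) * run X l := by
          rw [hZ, Equiv.swap_comm, Equiv.swap_mul_eq_mul_swap]
          rfl
        refine ⟨Z, ?_, p ∉ X, ?_, ?_⟩
        · rw [hZ', ascent_swap_mul]; exact ha
        · intro h; simp [gate_def, h, hZ']
        · intro h; simp [gate_def, not_not.1 h, hZ', ← mul_assoc]
    obtain ⟨Y', hY', hrun⟩ := ih hl Z
    obtain ⟨Y, hYp, hY⟩ := exists_mem_iff Y' hp Q
    have hYl : run Y l = run Z l := (run_congr hY).trans hrun
    refine ⟨Y, distinguished_cons.2 ⟨hYl ▸ hZ, hY'.congr fun q hq => (hY q hq).symm⟩, ?_⟩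
    by_cases h : Q
    · rw [run_cons, gate_def, if_pos (hYp.2 h), hYl, hQ.1 h, one_mul]
    · rw [run_cons, gate_def, if_neg (fun h' => h (hYp.1 h')), hYl, hQ.2 h]

/-! ### Labels on the edges of a grid -/

/-- Labels of pipes on an `n × n` grid of streets and avenues with elbows at `E`.
`L a b` is the label that enters the intersection `(a, b)` along the avenue `b`, and `R a (b + 1)`
the one that enters it along the street `a`; they leave as `L (a + 1) b` and `R a b`. -/
structure GridLabels (n : ℕ) (E : ℕ → ℕ → Prop) (L R : ℕ → ℕ → ℕ) : Prop where
  avenue_start : ∀ b < n, L 0 b = b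
  street_start : ∀ a < n, R a n = n + a
  avenue_elbow : ∀ a < n, ∀ b < n, E a b → L (a + 1) b = R a (b + 1)
  street_elbow : ∀ a < n, ∀ b < n, E a b → R a b = L a b
  avenue_cross : ∀ a < n, ∀ b < n, ¬ E a b → L (a + 1) b = L a b
  street_cross : ∀ a < n, ∀ b < n, ¬ E a b → R a b = R a (b + 1)

section

variable {n : ℕ} {E D : ℕ → ℕ → Prop} {L R : ℕ → ℕ → ℕ}

/-- Labels on the network above the street `a` are smaller than the label `n + a` that enters this
street. -/
theorem GridLabels.bounds (h : GridLabels n E L R) {a : ℕ} (ha : a ≤ n) :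
    (∀ b < n, L a b < n + a) ∧ (a < n → ∀ b ≤ n, R a b ≤ n + a) := by
  induction a with
  | zero =>
    have hL : ∀ b < n, L 0 b < n + 0 := fun b hb => by rw [h.avenue_start b hb]; omega
    refine ⟨hL, fun h0 b hb => ?_⟩
    induction hb using Nat.decreasingInduction with
    | self => rw [h.street_start 0 h0]
    | of_succ b hb ih =>
      by_cases he : E 0 b
      · rw [h.street_elbow 0 h0 b hb he]; exact (hL b hb).le
      · rw [h.street_cross 0 h0 b hb he]; exact ih
  | succ a ih =>
    obtain ⟨ihL, ihR⟩ := ih (by omega)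
    have hL : ∀ b < n, L (a + 1) b < n + (a + 1) := fun b hb => by
      by_cases he : E a b
      · rw [h.avenue_elbow a (by omega) b hb he]
        have := ihR (by omega) (b + 1) (by omega)
        omega
      · rw [h.avenue_cross a (by omega) b hb he]
        have := ihL b hb
        omega
    refine ⟨hL, fun h0 b hb => ?_⟩
    induction hb using Nat.decreasingInduction with
    | self => rw [h.street_start _ h0]
    | of_succ b hb ih =>
      by_cases he : E (a + 1) b
      · rw [h.street_elbow _ h0 b hb he]; exact (hL b hb).le
      · rw [h.street_cross _ h0 b hb he]; exact ih

/-- The label carried along a street comes from the start of the street, or from the avenue where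
the last elbow was. -/
theorem GridLabels.street_source (h : GridLabels n E L R) {a b : ℕ} (ha : a < n) (hb : b ≤ n) :
    R a b = n + a ∨ ∃ d, b ≤ d ∧ d < n ∧ E a d ∧ R a b = L a d := by
  induction hb using Nat.decreasingInduction with
  | self => exact .inl (h.street_start a ha)
  | of_succ b hb ih =>
    by_cases he : E a b
    · exact .inr ⟨b, le_rfl, hb, he, h.street_elbow a ha b hb he⟩
    · rw [h.street_cross a ha b hb he]
      rcases ih with h1 | ⟨d, h1, h2, h3, h4⟩
      · exact .inl h1
      · exact .inr ⟨d, by omega, h2, h3, h4⟩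

/-- The set `E` of elbows is union closed, where the union of an overlapping pair is only required
when the intersection of the pair is in `D`. -/
def ClosedOn (n : ℕ) (E D : ℕ → ℕ → Prop) : Prop :=
  ∀ p c a d, p < a → a < n → c < d → d < n → E p c → E a d → D a c → E p d

/-- A region that contains with each intersection those to its right on the same street, and those
before it on the same avenue. -/
structure IsRegion (n : ℕ) (D : ℕ → ℕ → Prop) : Prop where
  right : ∀ a c d, c ≤ d → d < n → D a c → D a d
  up : ∀ p a c, p ≤ a → D a c → D p c

/-- When two avenues carry labels in the wrong order, some earlier street has an elbow on the way
to the second avenue, but not at this avenue. -/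
theorem GridLabels.exists_of_inversion (h : GridLabels n E L R) {a : ℕ} (ha : a ≤ n)
    {b d : ℕ} (hbd : b < d) (hd : d < n)
    (hD : IsRegion n D) (hasc : ∀ p < a, ∀ c < n, D p c → L p c < R p (c + 1))
    (hreg : ∀ p < a, D p b) (hle : L a d ≤ L a b) :
    ∃ p < a, ∃ c, b ≤ c ∧ c < d ∧ E p c ∧ ¬ E p d := by
  induction a with
  | zero =>
    rw [h.avenue_start b (by omega), h.avenue_start d hd] at hle
    omega
  | succ a ih =>
    have hmono : ∀ c, b ≤ c → c < n → R a c ≤ R a (c + 1) := fun c hc hcn => by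
      by_cases he : E a c
      · rw [h.street_elbow a ha c hcn he]
        exact (hasc a (by omega) c hcn (hD.right a b c hc hcn (hreg a (by omega)))).le
      · rw [h.street_cross a ha c hcn he]
    have hasc' := hasc a (by omega)
    have hba := hreg a (by omega)
    by_cases hed : E a d
    · -- An elbow at `d` receives the largest of the labels that occur up to there.
      exfalso
      have h1 : R a (b + 1) ≤ R a d := by
        clear hed hle ih
        induction d, hbd using Nat.le_induction with
        | base => exact le_rfl
        | succ d hd' ih' => exact (ih' (by omega)).trans (hmono d (by omega) (by omega))
      have h2 : L (a + 1) b ≤ R a (b + 1) := by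
        by_cases heb : E a b
        · rw [h.avenue_elbow a ha b (by omega) heb]
        · rw [h.avenue_cross a ha b (by omega) heb]
          exact (hasc' b (by omega) hba).le
      have h3 := hasc' d hd (hD.right a b d hbd.le hd hba)
      rw [← h.street_elbow a ha d hd hed] at h3
      rw [h.avenue_elbow a ha d hd hed] at hle
      omega
    · by_cases heb : E a b
      · exact ⟨a, by omega, b, le_rfl, hbd, heb, hed⟩
      · rw [h.avenue_cross a ha d hd hed, h.avenue_cross a ha b (by omega) heb] at hle
        obtain ⟨p, hp, hrest⟩ := ih (by omega) (fun p hp => hasc p (by omega))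
          (fun p hp => hreg p (by omega)) hle
        exact ⟨p, by omega, hrest⟩

/-- If the elbows are closed, then pipes that meet have not crossed before. The label carried along
a street comes from its last elbow `(a, d)`; were it smaller than the label on a later avenue, then
closedness, applied to `(a, d)` and the elbow of `exists_of_inversion`, would be violated. -/
theorem ClosedOn.ascent (hE : ClosedOn n E D) (hD : IsRegion n D) (h : GridLabels n E L R) {a : ℕ}
    (ha : a < n) : ∀ b < n, D a b → L a b < R a (b + 1) := by
  induction a using Nat.strong_induction_on with
  | _ a ih =>
    intro b hb hab
    rcases h.street_source ha (show b + 1 ≤ n by omega) with h1 | ⟨d, h1, h2, h3, h4⟩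
    · rw [h1]
      exact (h.bounds ha.le).1 b hb
    · rw [h4]
      refine lt_of_not_ge fun hle => ?_
      obtain ⟨p, hp, c, hbc, hcd, hpc, hpd⟩ := h.exists_of_inversion ha.le h1 h2 hD
        (fun p hp => ih p hp (by omega)) (fun p hp => hD.up p a b hp.le hab) hle
      exact hpd (hE p c a d hp ha hcd h2 hpc h3 (hD.right a b c hbc (by omega) hab))

/-- If pipes that meet have not crossed before, then the elbows are closed. An elbow on a street,
where the avenue `d` further up has a crossing, puts a larger label to the left of the
one on the avenue `d`; then the latter must go straight on all later streets of the region. -/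
theorem GridLabels.closedOn (h : GridLabels n E L R) (hD : IsRegion n D)
    (hasc : ∀ a < n, ∀ b < n, D a b → L a b < R a (b + 1)) : ClosedOn n E D := by
  intro p c₀ a d hpa ha hcd₀ hd hpc₀ had hac₀
  by_contra hpd
  -- The last elbow before the avenue `d` on the street `p` puts a large label on its avenue.
  obtain ⟨c, hc₀, hcd, hpc, hR⟩ : ∃ c, c₀ ≤ c ∧ c < d ∧ E p c ∧ R p (c + 1) = R p d := by
    clear hpd had
    induction d, hcd₀ using Nat.le_induction with
    | base => exact ⟨c₀, le_rfl, by omega, hpc₀, rfl⟩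
    | succ d hd' ih =>
      by_cases he : E p d
      · exact ⟨d, by omega, by omega, he, rfl⟩
      · obtain ⟨c, h1, h2, h3, h4⟩ := ih (by omega)
        exact ⟨c, h1, by omega, h3, h4.trans (h.street_cross p (by omega) d (by omega) he)⟩
  have hac := hD.right a c₀ c hc₀ (by omega) hac₀
  have hmono : ∀ q ≤ a, ∀ b, c ≤ b → b < n → R q b ≤ R q (b + 1) := fun q hq b hb hbn => by
    by_cases he : E q b
    · rw [h.street_elbow q (by omega) b hbn he]
      exact (hasc q (by omega) b hbn (hD.right q c b hb hbn (hD.up q a c hq hac))).le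
    · rw [h.street_cross q (by omega) b hbn he]
  -- Two avenues with inverted labels stay inverted, and the second one has no elbow.
  have hstep : ∀ q ≤ a, L q d < L q c → ¬ E q d ∧ L (q + 1) d < L (q + 1) c := fun q hq hlt => by
    have hasc_c := hasc q (by omega) c (by omega) (hD.up q a c hq hac)
    have h1 : R q (c + 1) ≤ R q d := by
      clear hpd had hR hlt hcd₀
      induction d, hcd using Nat.le_induction with
      | base => exact le_rfl
      | succ d hd' ih => exact (ih (by omega)).trans (hmono q hq d (by omega) (by omega))
    have hnd : ¬ E q d := fun he => by
      rw [h.street_elbow q (by omega) d hd he] at h1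
      omega
    refine ⟨hnd, ?_⟩
    rw [h.avenue_cross q (by omega) d hd hnd]
    by_cases he : E q c
    · rw [h.avenue_elbow q (by omega) c (by omega) he]; omega
    · rw [h.avenue_cross q (by omega) c (by omega) he]; exact hlt
  have hinv : ∀ q, p + 1 ≤ q → q ≤ a → L q d < L q c := fun q hq => by
    induction q, hq using Nat.le_induction with
    | base =>
      intro _
      rw [h.avenue_cross p (by omega) d hd hpd, h.avenue_elbow p (by omega) c (by omega) hpc, hR,
        h.street_cross p (by omega) d hd hpd]
      exact hasc p (by omega) d hd (hD.right p c d hcd.le hd (hD.up p a c hpa.le hac))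
    | succ q hq ih => exact fun hqa => (hstep q (by omega) (ih (by omega))).2
  exact (hstep a le_rfl (hinv a hpa le_rfl)).1 had

end

/-! ### Labels on the edges of a grid, from a list of gates -/

/-- `st a b i` is the label in position `i` when the streets before `a`, and on the street `a` the
intersections with the avenues from `b` on, have acted. -/
structure GridStates (n : ℕ) (E : ℕ → ℕ → Prop) (st : ℕ → ℕ → ℕ → ℕ) : Prop where
  start : ∀ i, st 0 n i = i
  elbow : ∀ a < n, ∀ b < n, E a b → ∀ i, st a b i = st a (b + 1) i
  cross : ∀ a < n, ∀ b < n, ¬ E a b → ∀ i,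
    st a b i = st a (b + 1) (Equiv.swap (a + b) (a + b + 1) i)
  next : ∀ a < n, ∀ i, st (a + 1) n i = st a 0 i

namespace GridStates

variable {n : ℕ} {E : ℕ → ℕ → Prop} {st : ℕ → ℕ → ℕ → ℕ}

theorem step_of_ne (h : GridStates n E st) {a b i : ℕ} (ha : a < n) (hb : b < n)
    (h1 : i ≠ a + b) (h2 : i ≠ a + b + 1) : st a b i = st a (b + 1) i := by
  by_cases he : E a b
  · exact h.elbow a ha b hb he i
  · rw [h.cross a ha b hb he, Equiv.swap_apply_of_ne_of_ne h1 h2]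

theorem eq_of_lt (h : GridStates n E st) {a b i : ℕ} (ha : a < n) (hb : b ≤ n) (hi : i < a + b) :
    st a b i = st a n i := by
  induction hb using Nat.decreasingInduction with
  | self => rfl
  | of_succ b hb ih => rw [h.step_of_ne ha hb (by omega) (by omega), ih (by omega)]

theorem zero_eq_of_gt (h : GridStates n E st) {a b i : ℕ} (ha : a < n) (hb : b ≤ n)
    (hi : a + b < i) : st a 0 i = st a b i := by
  induction b with
  | zero => rfl
  | succ b ih => rw [ih (by omega) (by omega), h.step_of_ne ha hb (by omega) (by omega)]

theorem eq_self (h : GridStates n E st) {a i : ℕ} (ha : a ≤ n) (hi : n + a ≤ i) :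
    st a n i = i := by
  induction a with
  | zero => exact h.start i
  | succ a ih =>
    rw [h.next a ha, h.zero_eq_of_gt (b := n) ha le_rfl (by omega), ih (by omega) (by omega)]

theorem gridLabels (h : GridStates n E st) :
    GridLabels n E (fun a b => st a n (a + b)) (fun a b => st a b (a + b)) where
  avenue_start b _ := by simp [h.start]
  street_start a ha := by
    show st a n (a + n) = n + a
    rw [h.eq_self ha.le (by omega), add_comm]
  avenue_elbow a ha b hb he := by
    show st (a + 1) n (a + 1 + b) = st a (b + 1) (a + (b + 1))
    rw [h.next a ha, h.zero_eq_of_gt (b := b) ha hb.le (by omega), h.elbow a ha b hb he]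
    congr 1; omega
  street_elbow a ha b hb he := by
    show st a b (a + b) = st a n (a + b)
    rw [h.elbow a ha b hb he, h.eq_of_lt ha hb (by omega)]
  avenue_cross a ha b hb he := by
    show st (a + 1) n (a + 1 + b) = st a n (a + b)
    rw [h.next a ha, h.zero_eq_of_gt (b := b) ha hb.le (by omega), h.cross a ha b hb he,
      show a + 1 + b = a + b + 1 by omega, Equiv.swap_apply_right, h.eq_of_lt ha hb (by omega)]
  street_cross a ha b hb he := by
    show st a b (a + b) = st a (b + 1) (a + (b + 1))
    rw [h.cross a ha b hb he, Equiv.swap_apply_left]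
    rfl

end GridStates

/-- The intersection `q` is on an earlier street than `p`, or on the same one and further up. -/
def Before {n : ℕ} (q p : Fin n × Fin n) : Prop :=
  q.1 < p.1 ∨ q.1 = p.1 ∧ p.2 < q.2

instance {n : ℕ} (q p : Fin n × Fin n) : Decidable (Before q p) := by
  unfold Before; infer_instance

/-- The list `l` runs along each street from bottom to top, and through the streets from the last
to the first one: as the head of a list acts last, water goes down. -/
def IsDescending {n : ℕ} (l : List (Fin n × Fin n)) : Prop :=
  l.Pairwise fun p q => Before q p

theorem Before.asymm {n : ℕ} {p q : Fin n × Fin n} (h : Before p q) : ¬ Before q p := by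
  unfold Before at *; omega

theorem Before.ne {n : ℕ} {p q : Fin n × Fin n} (h : Before p q) : p ≠ q := by
  rintro rfl; exact h.asymm h

theorem IsDescending.nodup {n : ℕ} {l : List (Fin n × Fin n)} (hl : IsDescending l) : l.Nodup :=
  List.Pairwise.imp (fun h => h.ne.symm) hl

theorem IsDescending.eq_filter {n : ℕ} {l l' : List (Fin n × Fin n)} {p : Fin n × Fin n}
    (hl : IsDescending l) (h : p :: l' <:+ l) : l' = l.filter (Before · p) := by
  obtain ⟨k, rfl⟩ := h
  obtain ⟨-, h2, h3⟩ := List.pairwise_append.1 hl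
  obtain ⟨h4, -⟩ := List.pairwise_cons.1 h2
  rw [List.filter_append, List.filter_cons_of_neg (by simpa using fun h => h.asymm h),
    List.filter_eq_nil_iff.2, List.filter_eq_self.2, List.nil_append]
  · simpa using h4
  · intro q hq
    simpa using (h3 q hq p List.mem_cons_self).asymm

theorem IsDescending.forall_suffix {n : ℕ} {l : List (Fin n × Fin n)} (hl : IsDescending l)
    {Φ : Fin n × Fin n → List (Fin n × Fin n) → Prop} :
    (∀ p l', p :: l' <:+ l → Φ p l') ↔ ∀ p ∈ l, Φ p (l.filter (Before · p)) := by
  constructor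
  · intro h p hp
    obtain ⟨k, l', rfl⟩ := List.append_of_mem hp
    have hs : p :: l' <:+ k ++ p :: l' := List.suffix_append _ _
    rw [← hl.eq_filter hs]
    exact h p l' hs
  · intro h p l' hs
    rw [hl.eq_filter hs]
    exact h p (hs.subset List.mem_cons_self)

/-- The intersections of `l` on the streets before `a`, or on the street `a` and the avenues from
`b` on. -/
def doneList {n : ℕ} (l : List (Fin n × Fin n)) (a b : ℕ) : List (Fin n × Fin n) :=
  l.filter fun q => (q.1 : ℕ) < a ∨ (q.1 : ℕ) = a ∧ b ≤ q.2

theorem doneList_succ_eq {n : ℕ} (l : List (Fin n × Fin n)) (p : Fin n × Fin n) :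
    doneList l p.1 (p.2 + 1) = l.filter (Before · p) := by
  refine List.filter_congr fun q _ => decide_eq_decide.2 ?_
  unfold Before
  omega

theorem IsDescending.doneList_eq_cons {n : ℕ} {l : List (Fin n × Fin n)} (hl : IsDescending l)
    {p : Fin n × Fin n} (hp : p ∈ l) : doneList l p.1 p.2 = p :: doneList l p.1 (p.2 + 1) := by
  obtain ⟨k, l', rfl⟩ := List.append_of_mem hp
  have hs : p :: l' <:+ k ++ p :: l' := List.suffix_append _ _
  rw [doneList_succ_eq, ← hl.eq_filter hs, doneList]
  obtain ⟨-, h2, h3⟩ := List.pairwise_append.1 hl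
  obtain ⟨h4, -⟩ := List.pairwise_cons.1 h2
  rw [List.filter_append, List.filter_eq_nil_iff.2, List.filter_eq_self.2, List.nil_append]
  · intro q hq
    rcases List.mem_cons.1 hq with rfl | hq
    · simp
    · have := h4 q hq
      simp only [Before, decide_eq_true_eq] at *; omega
  · intro q hq
    have := h3 q hq p List.mem_cons_self
    simp only [Before, decide_eq_true_eq] at *; omega

theorem doneList_eq_of_notMem {n : ℕ} {l : List (Fin n × Fin n)}
    {p : Fin n × Fin n} (hp : p ∉ l) : doneList l p.1 p.2 = doneList l p.1 (p.2 + 1) := by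
  refine List.filter_congr fun q hq => ?_
  have : q ≠ p := by rintro rfl; exact hp hq
  simp only [Ne, Prod.ext_iff, Fin.ext_iff] at this
  simp only [decide_eq_decide]
  omega

/-- The faucet whose pipe is in position `i` after `σ`. Positions out of range keep their number. -/
def label {n : ℕ} (σ : Equiv.Perm (Fin (2 * n))) (i : ℕ) : ℕ :=
  if h : i < 2 * n then (σ.symm ⟨i, h⟩ : ℕ) else i

theorem label_swap_mul {n : ℕ} (σ : Equiv.Perm (Fin (2 * n))) (p : Fin n × Fin n) (i : ℕ) :
    label (Equiv.swap (lo p) (hi p) * σ) i =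
      label σ (Equiv.swap ((p.1 : ℕ) + p.2) ((p.1 : ℕ) + p.2 + 1) i) := by
  have e : (Equiv.swap (lo p) (hi p) * σ).symm = σ.symm * Equiv.swap (lo p) (hi p) := by
    ext; simp [Equiv.Perm.mul_def]
  have hlo : (lo p : ℕ) = p.1 + p.2 := rfl
  have hhi : (hi p : ℕ) = p.1 + p.2 + 1 := rfl
  have h1 := (lo p).2
  have h2 := (hi p).2
  rw [← hhi, ← hlo]
  by_cases hi1 : i = lo p
  · subst hi1; simp [label, e]
  by_cases hi2 : i = hi p
  · subst hi2; simp [label, e]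
  rw [Equiv.swap_apply_of_ne_of_ne hi1 hi2]
  unfold label
  split_ifs with h
  · rw [e, Equiv.Perm.mul_apply, Equiv.swap_apply_of_ne_of_ne] <;> simpa [Fin.ext_iff]
  · rfl

theorem ascent_iff_label {n : ℕ} {σ : Equiv.Perm (Fin (2 * n))} {p : Fin n × Fin n} :
    Ascent σ p ↔ label σ (p.1 + p.2) < label σ (p.1 + p.2 + 1) := by
  have h1 : (p.1 : ℕ) + p.2 < 2 * n := (lo p).2
  have h2 : (p.1 : ℕ) + p.2 + 1 < 2 * n := (hi p).2
  simp only [label, h1, h2, dif_pos]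
  rfl

/-- Elbows on the grid: the intersections out of `l` do nothing, so that they count as elbows. -/
def gridElbow {n : ℕ} (X : Finset (Fin n × Fin n)) (l : List (Fin n × Fin n)) (a b : ℕ) : Prop :=
  ∀ p : Fin n × Fin n, (p.1 : ℕ) = a → (p.2 : ℕ) = b → p ∈ l → p ∈ X

theorem gridElbow_iff {n : ℕ} {X : Finset (Fin n × Fin n)} {l : List (Fin n × Fin n)}
    {p : Fin n × Fin n} : gridElbow X l p.1 p.2 ↔ (p ∈ l → p ∈ X) := by
  constructor
  · exact fun h => h p rfl rfl
  · intro h q h1 h2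
    rwa [show q = p from Prod.ext (Fin.ext h1) (Fin.ext h2)]

theorem IsDescending.gridStates {n : ℕ} {l : List (Fin n × Fin n)} (hl : IsDescending l)
    (X : Finset (Fin n × Fin n)) :
    GridStates n (gridElbow X l) fun a b => label (run X (doneList l a b)) where
  start i := by
    have : doneList l 0 n = [] := by
      refine List.filter_eq_nil_iff.2 fun q _ => ?_
      simp
    simp only [this, run_nil, label, dite_eq_right_iff]
    exact fun _ => rfl
  elbow a ha b hb he i := by
    obtain ⟨p, rfl, rfl⟩ : ∃ p : Fin n × Fin n, (p.1 : ℕ) = a ∧ (p.2 : ℕ) = b :=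
      ⟨(⟨a, ha⟩, ⟨b, hb⟩), rfl, rfl⟩
    rw [gridElbow_iff] at he
    by_cases hp : p ∈ l
    · simp only [hl.doneList_eq_cons hp, run_cons, gate_def, if_pos (he hp), one_mul]
    · rw [doneList_eq_of_notMem hp]
  cross a ha b hb he i := by
    obtain ⟨p, rfl, rfl⟩ : ∃ p : Fin n × Fin n, (p.1 : ℕ) = a ∧ (p.2 : ℕ) = b :=
      ⟨(⟨a, ha⟩, ⟨b, hb⟩), rfl, rfl⟩
    rw [gridElbow_iff, Classical.not_imp] at he
    rw [hl.doneList_eq_cons he.1, run_cons, gate_def, if_neg he.2, label_swap_mul]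
  next a ha i := by
    have : doneList l (a + 1) n = doneList l a 0 := by
      refine List.filter_congr fun q _ => ?_
      simp only [decide_eq_decide]
      omega
    rw [this]

/-- Label that enters the intersection `(a, b)` along the avenue `b`. It is in position `a + b` from
the start of the street `a` on. -/
def avenueLabel {n : ℕ} (X : Finset (Fin n × Fin n)) (l : List (Fin n × Fin n)) (a b : ℕ) : ℕ :=
  label (run X (doneList l a n)) (a + b)

/-- Label that leaves the intersection `(a, b)` along the street `a`. It is in position `a + b` as
soon as `(a, b)` has acted. -/
def streetLabel {n : ℕ} (X : Finset (Fin n × Fin n)) (l : List (Fin n × Fin n)) (a b : ℕ) : ℕ :=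
  label (run X (doneList l a b)) (a + b)

theorem IsDescending.gridLabels {n : ℕ} {l : List (Fin n × Fin n)} (hl : IsDescending l)
    (X : Finset (Fin n × Fin n)) :
    GridLabels n (gridElbow X l) (avenueLabel X l) (streetLabel X l) :=
  (hl.gridStates X).gridLabels

theorem IsDescending.label_lo {n : ℕ} {l : List (Fin n × Fin n)} (hl : IsDescending l)
    (X : Finset (Fin n × Fin n)) (p : Fin n × Fin n) :
    label (run X (l.filter (Before · p))) (p.1 + p.2) = avenueLabel X l p.1 p.2 := by
  rw [← doneList_succ_eq]
  exact (hl.gridStates X).eq_of_lt p.1.2 p.2.2 (by omega)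

theorem label_hi {n : ℕ} {l : List (Fin n × Fin n)}
    (X : Finset (Fin n × Fin n)) (p : Fin n × Fin n) :
    label (run X (l.filter (Before · p))) (p.1 + p.2 + 1) = streetLabel X l p.1 (p.2 + 1) := by
  rw [← doneList_succ_eq]
  rfl

theorem IsDescending.distinguished_iff {n : ℕ} {l : List (Fin n × Fin n)} (hl : IsDescending l)
    {X : Finset (Fin n × Fin n)} :
    Distinguished X l ↔ ∀ p ∈ l, avenueLabel X l p.1 p.2 < streetLabel X l p.1 (p.2 + 1) := by
  unfold Distinguished
  rw [hl.forall_suffix (Φ := fun p l' => Ascent (run X l') p)]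
  simp only [ascent_iff_label, hl.label_lo, label_hi]

/-! ### Union closed and intersection closed collections -/

theorem mem_intersections {n : ℕ} {p : Fin n × Fin n} : p ∈ intersections n ↔ p.1 ≤ p.2 := by
  obtain ⟨a, b⟩ := p
  simp [intersections]

theorem pairwise_intersections (n : ℕ) : (intersections n).Pairwise Before := by
  rw [intersections, List.pairwise_flatMap]
  constructor
  · intro a _
    rw [List.pairwise_map, List.pairwise_reverse]
    refine ((List.pairwise_lt_finRange n).filter _).imp fun h => ?_
    exact Or.inr ⟨rfl, h⟩
  · refine (List.pairwise_lt_finRange n).imp fun {a b} h => ?_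
    intro p hp q hq
    simp only [List.mem_map] at hp hq
    obtain ⟨_, -, rfl⟩ := hp
    obtain ⟨_, -, rfl⟩ := hq
    exact Or.inl h

theorem isDescending_reverse_intersections (n : ℕ) : IsDescending (intersections n).reverse :=
  List.pairwise_reverse.2 (pairwise_intersections n)

theorem length_intersections (n : ℕ) : (intersections n).length = n * (n + 1) / 2 := by
  have h1 : ∀ a : Fin n, ((List.finRange n).filter fun b => a ≤ b).length = n - a := by
    intro a
    rw [← Fin.card_Ici, ← List.toFinset_card_of_nodup ((List.nodup_finRange n).filter _)]
    congr 1
    ext b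
    simp
  rw [intersections, List.length_flatMap]
  simp only [List.length_map, List.length_reverse, h1]
  have h2 : ∀ m, (∑ i ∈ Finset.range m, (m - i)) * 2 = m * (m + 1) := by
    intro m
    induction m with
    | zero => simp
    | succ m ih =>
      rw [Finset.sum_range_succ', add_mul]
      simp only [Nat.add_sub_add_right, ih, Nat.sub_zero]
      ring
  rw [← List.ofFn_eq_map, List.sum_ofFn, Fin.sum_univ_eq_sum_range (fun i => n - i), ← h2 n,
    Nat.mul_div_cancel _ two_pos]

theorem IsIntervalCollection.card_eq {n : ℕ} {X : Finset (Fin n × Fin n)}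
    (hX : IsIntervalCollection X) : ((intersections n).filter (· ∈ X)).length = X.card := by
  have hnd : (intersections n).Nodup :=
    List.nodup_reverse.1 (isDescending_reverse_intersections n).nodup
  rw [← List.toFinset_card_of_nodup (hnd.filter _)]
  congr 1
  ext p
  simpa [mem_intersections] using hX p

theorem isRegion_le (n : ℕ) : IsRegion n fun a b => a ≤ b where
  right _ _ _ h _ h' := h'.trans h
  up _ _ _ h h' := h.trans h'

theorem isRegion_true (n : ℕ) : IsRegion n fun _ _ => True where
  right _ _ _ _ _ _ := trivial
  up _ _ _ _ _ := trivial

theorem unionClosed_iff_closedOn {n : ℕ} {X : Finset (Fin n × Fin n)} :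
    UnionClosed X ↔ IsIntervalCollection X ∧
      ClosedOn n (gridElbow X (intersections n).reverse) fun a b => a ≤ b := by
  refine and_congr_right fun _ => ⟨fun h p c a d hpa ha hcd hd hpc had hac => ?_,
    fun h a b c d hab hbc hcd hac hbd => ?_⟩
  · have e1 := (gridElbow_iff (p := ((⟨p, by omega⟩, ⟨c, by omega⟩) : Fin n × Fin n))).1 hpc
      (by simp [mem_intersections]; omega)
    have e2 := (gridElbow_iff (p := ((⟨a, by omega⟩, ⟨d, by omega⟩) : Fin n × Fin n))).1 had
      (by simp [mem_intersections]; omega)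
    exact (gridElbow_iff (p := ((⟨p, by omega⟩, ⟨d, by omega⟩) : Fin n × Fin n))).2 fun _ =>
      h _ _ _ _ (Fin.mk_le_mk.2 hpa.le) (Fin.mk_le_mk.2 hac) (Fin.mk_le_mk.2 hcd.le) e1 e2
  · rcases hab.eq_or_lt with rfl | hab
    · exact hbd
    rcases hcd.eq_or_lt with rfl | hcd
    · exact hac
    refine gridElbow_iff.1 (h a c b d hab b.2 hcd d.2
      (gridElbow_iff.2 fun _ => hac) (gridElbow_iff.2 fun _ => hbd) hbc) ?_
    rw [List.mem_reverse, mem_intersections]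
    exact (hab.le.trans hbc).trans hcd.le

theorem unionClosed_iff_distinguished {n : ℕ} {X : Finset (Fin n × Fin n)} :
    UnionClosed X ↔ IsIntervalCollection X ∧ Distinguished X (intersections n).reverse := by
  have hl := isDescending_reverse_intersections n
  have hg := hl.gridLabels X
  rw [unionClosed_iff_closedOn, hl.distinguished_iff]
  refine and_congr_right fun _ => ⟨fun h p hp => ?_, fun h => ?_⟩
  · rw [List.mem_reverse, mem_intersections] at hp
    exact h.ascent (isRegion_le n) hg p.1.2 _ p.2.2 hp
  · refine hg.closedOn (isRegion_le n) fun a ha b hb hab => ?_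
    exact h (⟨a, ha⟩, ⟨b, hb⟩) (by simpa [mem_intersections] using hab)

/-- The half-turn of the grid. -/
def rot {n : ℕ} (p : Fin n × Fin n) : Fin n × Fin n := (p.1.rev, p.2.rev)

@[simp] theorem rot_rot {n : ℕ} (p : Fin n × Fin n) : rot (rot p) = p := by simp [rot]

theorem mem_image_rot {n : ℕ} {X : Finset (Fin n × Fin n)} {p : Fin n × Fin n} :
    p ∈ X.image rot ↔ rot p ∈ X := by
  rw [Finset.mem_image]
  exact ⟨by rintro ⟨q, hq, rfl⟩; rwa [rot_rot], fun h => ⟨_, h, rot_rot p⟩⟩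

theorem mem_map_rot {n : ℕ} {p : Fin n × Fin n} :
    p ∈ (intersections n).map rot ↔ p.2 ≤ p.1 := by
  rw [List.mem_map]
  constructor
  · rintro ⟨q, hq, rfl⟩
    simpa [rot, mem_intersections] using hq
  · intro h
    exact ⟨rot p, by simpa [rot, mem_intersections] using h, rot_rot p⟩

theorem isDescending_map_rot (n : ℕ) : IsDescending ((intersections n).map rot) := by
  rw [IsDescending, List.pairwise_map]
  refine (pairwise_intersections n).imp fun {p q} h => ?_
  simp only [Before, rot, Fin.rev_lt_rev, Fin.rev_inj] at *
  exact h.imp_right fun h => ⟨h.1.symm, h.2⟩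

theorem gate_image_rot {n : ℕ} (X : Finset (Fin n × Fin n)) (p : Fin n × Fin n) :
    gate (X.image rot) (rot p) = Fin.revPerm * gate X p * Fin.revPerm := by
  have h1 : lo (rot p) = (hi p).rev := by
    ext; simp only [lo, hi, rot, Fin.val_rev]; omega
  have h2 : hi (rot p) = (lo p).rev := by
    ext; simp only [lo, hi, rot, Fin.val_rev]; omega
  have h3 : (Fin.revPerm : Equiv.Perm (Fin (2 * n))) * Fin.revPerm = 1 := by
    ext; simp
  simp only [gate_def, mem_image_rot, rot_rot, h1, h2]
  split_ifs
  · simp [h3]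
  · rw [Equiv.mul_swap_eq_swap_mul, mul_assoc, h3, mul_one, Equiv.swap_comm, Fin.revPerm_apply,
      Fin.revPerm_apply]

theorem run_image_rot {n : ℕ} (X : Finset (Fin n × Fin n)) (l : List (Fin n × Fin n)) :
    run (X.image rot) (l.map rot) = Fin.revPerm * run X l * Fin.revPerm := by
  have h3 : (Fin.revPerm : Equiv.Perm (Fin (2 * n))) * Fin.revPerm = 1 := by
    ext; simp
  induction l with
  | nil => simp [h3]
  | cons p l ih =>
    rw [List.map_cons, run_cons, run_cons, ih, gate_image_rot]
    calc _ = Fin.revPerm * gate X p * (Fin.revPerm * Fin.revPerm) * run X l * Fin.revPerm := by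
            simp only [mul_assoc]
      _ = _ := by rw [h3]; simp only [mul_assoc, one_mul]

theorem run_intersections {n : ℕ} (X : Finset (Fin n × Fin n)) :
    run X (intersections n) = (plumbing X)⁻¹ := by
  have h : ∀ p, (gate X p)⁻¹ = gate X p := fun p => by
    rw [gate_def]; split_ifs <;> simp
  rw [plumbing, List.prod_inv_reverse, List.map_reverse, List.reverse_reverse, List.map_map, run]
  congr 1
  exact List.map_congr_left fun p _ => (h p).symm

/-- A half-turn of the network exchanges the faucets and the customers. -/
theorem run_map_rot {n : ℕ} (X : Finset (Fin n × Fin n)) :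
    run (X.image rot) ((intersections n).map rot) =
      Fin.revPerm * (plumbing X)⁻¹ * Fin.revPerm := by
  rw [run_image_rot, run_intersections]

theorem intersectionClosed_iff_closedOn {n : ℕ} {X : Finset (Fin n × Fin n)} :
    IntersectionClosed X ↔ IsIntervalCollection X ∧
      ClosedOn n (gridElbow (X.image rot) ((intersections n).map rot)) fun _ _ => True := by
  refine and_congr_right fun _ => ⟨fun h p c a d hpa ha hcd hd hpc had _ => ?_,
    fun h a b c d hab hbc hcd hac hbd => ?_⟩
  · refine (gridElbow_iff (p := ((⟨p, by omega⟩, ⟨d, by omega⟩) : Fin n × Fin n))).2 fun hdp => ?_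
    rw [mem_map_rot, Fin.mk_le_mk] at hdp
    have e1 := (gridElbow_iff (p := ((⟨p, by omega⟩, ⟨c, by omega⟩) : Fin n × Fin n))).1 hpc
      (by rw [mem_map_rot, Fin.mk_le_mk]; omega)
    have e2 := (gridElbow_iff (p := ((⟨a, by omega⟩, ⟨d, by omega⟩) : Fin n × Fin n))).1 had
      (by rw [mem_map_rot, Fin.mk_le_mk]; omega)
    rw [mem_image_rot] at e1 e2 ⊢
    exact h _ _ _ _ (Fin.rev_le_rev.2 (Fin.mk_le_mk.2 hpa.le))
      (Fin.rev_le_rev.2 (Fin.mk_le_mk.2 hdp)) (Fin.rev_le_rev.2 (Fin.mk_le_mk.2 hcd.le)) e2 e1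
  · rcases hab.eq_or_lt with rfl | hab
    · exact hac
    rcases hcd.eq_or_lt with rfl | hcd
    · exact hbd
    have e := h b.rev d.rev a.rev c.rev (Fin.rev_lt_rev.2 hab) a.rev.2 (Fin.rev_lt_rev.2 hcd)
      c.rev.2 (gridElbow_iff (p := rot (b, d)).2 fun _ => by rwa [mem_image_rot, rot_rot])
      (gridElbow_iff (p := rot (a, c)).2 fun _ => by rwa [mem_image_rot, rot_rot]) trivial
    have := gridElbow_iff (p := rot (b, c)).1 e (by rw [mem_map_rot]; simpa [rot] using hbc)
    rwa [mem_image_rot, rot_rot] at this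

/-- Nothing happens to the pipes in the part of the grid above the diagonal if it only has
elbows. -/
theorem GridLabels.eq_add_of_elbow {n : ℕ} {E : ℕ → ℕ → Prop} {L R : ℕ → ℕ → ℕ}
    (h : GridLabels n E L R) (hE : ∀ a b, a < b → b < n → E a b) {a : ℕ} :
    (∀ b, a ≤ b → b < n → L a b = a + b) ∧ (∀ b, a < b → b ≤ n → R a b = a + b) := by
  have key : ∀ a, (∀ b, a ≤ b → b < n → L a b = a + b) →
      (∀ b, a < b → b ≤ n → R a b = a + b) := by
    intro a hL b hab hb
    rcases hb.eq_or_lt with rfl | hb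
    · rw [h.street_start a hab, add_comm]
    · rw [h.street_elbow a (by omega) b hb (hE a b hab hb), hL b hab.le hb]
  have hL : ∀ b, a ≤ b → b < n → L a b = a + b := by
    induction a with
    | zero => intro b _ hb; rw [h.avenue_start b hb, zero_add]
    | succ a ih =>
      intro b hab hb
      rw [h.avenue_elbow a (by omega) b hb (hE a b hab hb), key a ih (b + 1) (by omega) hb]
      omega
  exact ⟨hL, key a hL⟩

theorem intersectionClosed_iff_distinguished {n : ℕ} {X : Finset (Fin n × Fin n)} :
    IntersectionClosed X ↔ IsIntervalCollection X ∧
      Distinguished (X.image rot) ((intersections n).map rot) := by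
  have hl := isDescending_map_rot n
  have hg := hl.gridLabels (X.image rot)
  rw [intersectionClosed_iff_closedOn, hl.distinguished_iff]
  refine and_congr_right fun _ => ⟨fun h p _ => ?_, fun h => ?_⟩
  · exact h.ascent (isRegion_true n) hg p.1.2 _ p.2.2 trivial
  · refine hg.closedOn (isRegion_true n) fun a ha b hb _ => ?_
    by_cases hab : b ≤ a
    · exact h (⟨a, ha⟩, ⟨b, hb⟩) (by rwa [mem_map_rot, Fin.mk_le_mk])
    · have hE : ∀ a b, a < b → b < n →
          gridElbow (X.image rot) ((intersections n).map rot) a b := by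
        rintro _ _ hab hb p rfl rfl hp
        rw [mem_map_rot] at hp
        exact absurd hp (not_le.2 hab)
      have := hg.eq_add_of_elbow hE (a := a)
      rw [this.1 b (by omega) hb, this.2 (b + 1) (by omega) hb]
      omega

/-! ### Yoshi permutations are the bill assignments -/

theorem GridLabels.eq_of_cross {n : ℕ} {E : ℕ → ℕ → Prop} {L R : ℕ → ℕ → ℕ}
    (h : GridLabels n E L R) (hE : ∀ a b, a ≤ b → b < n → ¬ E a b) (a : ℕ) :
    (∀ b, a ≤ b + 1 → b < n → L a b = b) ∧ (a < n → ∀ b, a ≤ b → b ≤ n → R a b = n + a) := by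
  constructor
  · induction a with
    | zero => intro b _ hb; exact h.avenue_start b hb
    | succ a ih =>
      intro b hab hb
      rw [h.avenue_cross a (by omega) b hb (hE a b (by omega) hb), ih b (by omega) hb]
  · intro ha b hab hb
    induction hb using Nat.decreasingInduction with
    | self => exact h.street_start a ha
    | of_succ b hb ih =>
      rw [h.street_cross a (by omega) b hb (hE a b hab hb), ih (by omega)]

theorem GridStates.final_eq {n : ℕ} {E : ℕ → ℕ → Prop} {st : ℕ → ℕ → ℕ → ℕ}
    (h : GridStates n E st) (hE : ∀ a b, b < a → a < n → E a b) {a : ℕ} (ha : a < n) :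
    st n n (2 * a) = st a a (a + a) ∧ st n n (2 * a + 1) = st (a + 1) n (a + 1 + a) := by
  -- From the street `a` on, the intersections only move positions from `2 * a` on.
  have h0 : ∀ a < n, ∀ i, st a 0 i = st a a i := fun a ha i => by
    have : ∀ b ≤ a, st a 0 i = st a b i := fun b hb => by
      induction b with
      | zero => rfl
      | succ b ih => rw [ih (by omega), h.elbow a ha b (by omega) (hE a b hb ha)]
    exact this a le_rfl
  have h1 : ∀ c, a + 1 ≤ c → c ≤ n → ∀ i < 2 * (a + 1), st c n i = st (a + 1) n i := by
    intro c hc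
    induction c, hc using Nat.le_induction with
    | base => exact fun _ _ _ => rfl
    | succ c hc ih =>
      intro hcn i hi
      rw [h.next c hcn, h0 c hcn, h.eq_of_lt hcn (by omega) (by omega), ih (by omega) i hi]
  constructor
  · rw [h1 n ha le_rfl _ (by omega), h.next a ha, h0 a ha, two_mul]
  · rw [h1 n ha le_rfl _ (by omega)]
    congr 1
    omega

/-- `σ` takes smaller values than `τ` on the first half of `[2n]`, and larger ones on the other
half. -/
def HalfLE {n : ℕ} (σ τ : Equiv.Perm (Fin (2 * n))) : Prop :=
  ∀ k : Fin (2 * n), ((k : ℕ) < n → σ k ≤ τ k) ∧ (n ≤ (k : ℕ) → τ k ≤ σ k)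

/-- `τ` is increasing on both halves of `[2n]`. -/
def HalfMono {n : ℕ} (τ : Equiv.Perm (Fin (2 * n))) : Prop :=
  ∀ j k : Fin (2 * n), j < k → ((k : ℕ) < n ∨ n ≤ (j : ℕ)) → τ j < τ k

theorem HalfLE.eq_one {n : ℕ} {σ : Equiv.Perm (Fin (2 * n))} (h : HalfLE σ 1) : σ = 1 := by
  have h1 : ∀ m, ∀ k : Fin (2 * n), (k : ℕ) = m → (k : ℕ) < n → σ k = k := by
    intro m
    induction m using Nat.strong_induction_on with
    | _ m ih =>
      rintro k rfl hk
      rcases ((h k).1 hk).eq_or_lt with h' | h'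
      · exact h'
      · have hlt : σ k < k := h'
        exact σ.injective (ih (σ k) hlt (σ k) rfl (lt_trans hlt hk))
  have h2 : ∀ m, ∀ k : Fin (2 * n), 2 * n - (k : ℕ) = m → n ≤ (k : ℕ) → σ k = k := by
    intro m
    induction m using Nat.strong_induction_on with
    | _ m ih =>
      rintro k rfl hk
      rcases ((h k).2 hk).eq_or_lt with h' | h'
      · exact h'.symm
      · have hlt : k < σ k := h'
        have hlt' : (k : ℕ) < σ k := hlt
        exact σ.injective (ih (2 * n - σ k) (by omega) (σ k) rfl (by omega))
  ext k
  rw [Equiv.Perm.one_apply]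
  rcases lt_or_ge (k : ℕ) n with hk | hk
  · rw [h1 _ k rfl hk]
  · rw [h2 _ k rfl hk]

theorem swap_val {n : ℕ} (p : Fin n × Fin n) (x : Fin (2 * n)) :
    (Equiv.swap (lo p) (hi p) x : ℕ) =
      if (x : ℕ) = lo p then (lo p : ℕ) + 1 else if (x : ℕ) = lo p + 1 then (lo p : ℕ) else x := by
  have := lo_add_one p
  simp only [Equiv.swap_apply_def, Fin.ext_iff]
  split_ifs
  all_goals omega

/-- The faucet on top of the avenue of `p`. -/
def avenueFaucet {n : ℕ} (p : Fin n × Fin n) : Fin (2 * n) := ⟨p.2, by omega⟩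

/-- The faucet on top of the street of `p`. -/
def streetFaucet {n : ℕ} (p : Fin n × Fin n) : Fin (2 * n) := ⟨n + p.1, by omega⟩

section

variable {n : ℕ} {σ τ : Equiv.Perm (Fin (2 * n))} {p : Fin n × Fin n}
  (h1 : τ (avenueFaucet p) = lo p) (h2 : τ (streetFaucet p) = hi p)

include h1 h2

theorem val_eq_lo_or (k : Fin (2 * n)) :
    ((τ k : ℕ) = lo p ∧ (k : ℕ) < n) ∨ ((τ k : ℕ) = lo p + 1 ∧ n ≤ (k : ℕ)) ∨
      ((τ k : ℕ) ≠ lo p ∧ (τ k : ℕ) ≠ lo p + 1) := by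
  rw [lo_add_one p, ← h1, ← h2]
  simp only [← Fin.ext_iff, Ne, EmbeddingLike.apply_eq_iff_eq]
  have := p.2.2
  by_cases e1 : k = avenueFaucet p
  · subst e1; exact .inl ⟨rfl, this⟩
  · by_cases e2 : k = streetFaucet p
    · subst e2; exact .inr (.inl ⟨rfl, Nat.le_add_right _ _⟩)
    · exact .inr (.inr ⟨e1, e2⟩)

theorem HalfMono.swap_mul (h : HalfMono τ) : HalfMono (Equiv.swap (lo p) (hi p) * τ) := by
  intro j k hjk hh
  have e := h j k hjk hh
  have ej := val_eq_lo_or h1 h2 j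
  have ek := val_eq_lo_or h1 h2 k
  rw [Fin.lt_def] at *
  simp only [Equiv.Perm.mul_apply, swap_val]
  split_ifs <;> omega

theorem HalfLE.swap_mul_right (h : HalfLE σ τ) : HalfLE σ (Equiv.swap (lo p) (hi p) * τ) := by
  intro k
  have e := h k
  have ek := val_eq_lo_or h1 h2 k
  simp only [Fin.le_def, Equiv.Perm.mul_apply, swap_val] at *
  split_ifs <;> omega

theorem HalfLE.swap_mul_both (h : HalfLE σ τ) :
    HalfLE (Equiv.swap (lo p) (hi p) * σ) (Equiv.swap (lo p) (hi p) * τ) := by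
  intro k
  have e := h k
  have ek := val_eq_lo_or h1 h2 k
  simp only [Fin.le_def, Equiv.Perm.mul_apply, swap_val] at *
  split_ifs <;> omega

theorem HalfLE.swap_mul_left (h : HalfLE σ (Equiv.swap (lo p) (hi p) * τ)) :
    HalfLE (Equiv.swap (lo p) (hi p) * σ) (Equiv.swap (lo p) (hi p) * τ) := by
  intro k
  have e := h k
  have ek := val_eq_lo_or h1 h2 k
  simp only [Fin.le_def, Equiv.Perm.mul_apply, swap_val] at *
  split_ifs at * <;> omega

/-- Lifting property: below a product with a crossing at `p`, a permutation that has the labels at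
`p` in increasing order is already below the product without this crossing. -/
theorem HalfLE.of_ascent (h : HalfLE σ (Equiv.swap (lo p) (hi p) * τ)) (hτ : HalfMono τ)
    (hσ : Ascent σ p) : HalfLE σ τ := by
  have hp := p.2.2
  have hσlo : σ (σ.symm (lo p)) = lo p := σ.apply_symm_apply _
  have hσhi : σ (σ.symm (hi p)) = hi p := σ.apply_symm_apply _
  have hhi := lo_add_one p
  intro k
  have e := h k
  have ek := val_eq_lo_or h1 h2 k
  simp only [Fin.le_def, Equiv.Perm.mul_apply, swap_val] at *
  constructor
  · intro hk
    refine le_of_not_gt fun hlt => ?_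
    have hk1 : (τ k : ℕ) = lo p := by split_ifs at e <;> omega
    have hk2 : σ k = hi p := by
      rw [Fin.ext_iff]; split_ifs at e; omega
    rw [Ascent, ← hk2, Equiv.symm_apply_apply] at hσ
    have hj := h (σ.symm (lo p))
    have ej := val_eq_lo_or h1 h2 (σ.symm (lo p))
    have hm := hτ _ _ hσ (.inl hk)
    simp only [Fin.le_def, Fin.lt_def, Equiv.Perm.mul_apply, swap_val, hσlo] at hj hm hσ
    split_ifs at hj <;> omega
  · intro hk
    refine le_of_not_gt fun hlt => ?_
    have hk1 : (τ k : ℕ) = lo p + 1 := by split_ifs at e <;> omega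
    have hk2 : σ k = lo p := by
      rw [Fin.ext_iff]; split_ifs at e <;> omega
    rw [Ascent, ← hk2, Equiv.symm_apply_apply] at hσ
    have hj := h (σ.symm (hi p))
    have ej := val_eq_lo_or h1 h2 (σ.symm (hi p))
    have hσ' : σ.symm (σ k) < σ.symm (hi p) := by simpa using hσ
    have hm := hτ _ _ hσ (.inr hk)
    simp only [Fin.le_def, Fin.lt_def, Equiv.Perm.mul_apply, swap_val, hσhi] at hj hm hσ
    split_ifs at hj <;> omega

end

/-- If the pipes of the street and the avenue of `p` arrive at each `p` when there are only
crossings, then the products of subwords are the permutations below the product of the word. -/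
theorem halfLE_run_empty_iff {n : ℕ} {l : List (Fin n × Fin n)} (hl : l.Nodup)
    (h : ∀ p l', p :: l' <:+ l →
      run ∅ l' (avenueFaucet p) = lo p ∧ run ∅ l' (streetFaucet p) = hi p) :
    HalfMono (run ∅ l) ∧ ∀ σ, HalfLE σ (run ∅ l) ↔ ∃ X, run X l = σ := by
  induction l with
  | nil =>
    refine ⟨fun j k hjk _ => hjk, fun σ => ⟨fun hσ => ⟨∅, hσ.eq_one.symm⟩, ?_⟩⟩
    rintro ⟨X, rfl⟩
    exact fun k => ⟨fun _ => le_rfl, fun _ => le_rfl⟩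
  | cons p l ih =>
    obtain ⟨hp, hl⟩ := List.nodup_cons.1 hl
    obtain ⟨h1, h2⟩ := h p l List.suffix_rfl
    obtain ⟨hmono, hiff⟩ := ih hl fun q l' hq => h q l' (hq.trans (List.suffix_cons p l))
    have hrun : run ∅ (p :: l) = Equiv.swap (lo p) (hi p) * run ∅ l := by
      simp [gate_def]
    rw [hrun]
    refine ⟨hmono.swap_mul h1 h2, fun σ => ⟨fun hσ => ?_, ?_⟩⟩
    · by_cases ha : Ascent σ p
      · obtain ⟨X, hX⟩ := (hiff σ).1 (hσ.of_ascent h1 h2 hmono ha)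
        obtain ⟨Y, hY1, hY2⟩ := exists_mem_iff X hp True
        exact ⟨Y, by simp [gate_def, hY1, run_congr hY2, hX]⟩
      · obtain ⟨X, hX⟩ := (hiff _).1 ((hσ.swap_mul_left h1 h2).of_ascent h1 h2 hmono
          (ascent_swap_mul.2 ha))
        obtain ⟨Y, hY1, hY2⟩ := exists_mem_iff X hp False
        exact ⟨Y, by simp [gate_def, hY1, run_congr hY2, hX, ← mul_assoc]⟩
    · rintro ⟨X, rfl⟩
      have hX := (hiff _).2 ⟨X, rfl⟩
      by_cases hpX : p ∈ X
      · simpa [gate_def, hpX] using hX.swap_mul_right h1 h2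
      · simpa [gate_def, hpX] using hX.swap_mul_both h1 h2

theorem label_eq_iff {n : ℕ} {σ : Equiv.Perm (Fin (2 * n))} {i j : Fin (2 * n)} :
    label σ i = j ↔ σ j = i := by
  simp only [label, i.2, dif_pos, Fin.eta]
  rw [← Fin.ext_iff, Equiv.symm_apply_eq, eq_comm]

theorem not_gridElbow_empty {n : ℕ} {a b : ℕ} (hab : a ≤ b) (hb : b < n) :
    ¬ gridElbow (n := n) ∅ (intersections n).reverse a b := by
  have := gridElbow_iff (X := ∅) (l := (intersections n).reverse)
    (p := (⟨a, by omega⟩, ⟨b, hb⟩))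
  rw [this]
  simpa [mem_intersections] using hab

/-- With crossings only, the pipes follow the avenues and the streets. -/
theorem plumbing_empty_apply {n : ℕ} (a : Fin n) :
    (plumbing (∅ : Finset (Fin n × Fin n)) ⟨a, by omega⟩ : ℕ) = 2 * a + 1 ∧
      (plumbing (∅ : Finset (Fin n × Fin n)) ⟨n + a, by omega⟩ : ℕ) = 2 * a := by
  have hl := isDescending_reverse_intersections n
  have hst := hl.gridStates ∅
  have hgr := (hl.gridLabels ∅).eq_of_cross (fun _ _ => not_gridElbow_empty)
  have hfin := hst.final_eq (fun a b hba ha => ?_) a.2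
  · have hdone : doneList (intersections n).reverse n n = (intersections n).reverse :=
      List.filter_eq_self.2 fun q _ => by simp
    rw [hdone, ← plumbing_eq_run] at hfin
    have e1 := hfin.1.trans ((hgr a).2 a.2 a le_rfl a.2.le)
    have e2 := hfin.2.trans ((hgr (a + 1)).1 a le_rfl a.2)
    have e1' := label_eq_iff (i := ⟨2 * a, by omega⟩) (j := ⟨n + a, by omega⟩) |>.1 e1
    have e2' := label_eq_iff (i := ⟨2 * a + 1, by omega⟩) (j := ⟨a, by omega⟩) |>.1 e2
    rw [e1', e2']
    exact ⟨rfl, rfl⟩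
  · rintro p rfl rfl hp
    rw [List.mem_reverse, mem_intersections] at hp
    exact absurd hba (not_lt.2 hp)

theorem plumbing_empty_of_lt {n : ℕ} {x : Fin (2 * n)} (hx : (x : ℕ) < n) :
    (plumbing (∅ : Finset (Fin n × Fin n)) x : ℕ) = 2 * x + 1 :=
  (plumbing_empty_apply ⟨x, hx⟩).1

theorem plumbing_empty_of_le {n : ℕ} {x : Fin (2 * n)} (hx : n ≤ (x : ℕ)) :
    (plumbing (∅ : Finset (Fin n × Fin n)) x : ℕ) = 2 * (x - n) := by
  have hlt : (x : ℕ) - n < n := by omega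
  have h := (plumbing_empty_apply ⟨(x : ℕ) - n, hlt⟩).2
  simpa only [Nat.add_sub_cancel' hx, Fin.eta] using h

theorem isYoshi_iff_halfLE {n : ℕ} {σ : Equiv.Perm (Fin (2 * n))} :
    IsYoshi σ ↔ HalfLE σ (plumbing ∅) := by
  constructor
  · intro h k
    constructor
    · intro hk
      have e := (h ⟨k, hk⟩).1
      simp only [Fin.eta] at e
      rw [Fin.le_def, plumbing_empty_of_lt hk]
      omega
    · intro hk
      have e := (h ⟨2 * n - 1 - k, by omega⟩).2
      rw [show Fin.rev (⟨2 * n - 1 - (k : ℕ), by omega⟩ : Fin (2 * n)) = k from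
        Fin.ext (by simp only [Fin.val_rev]; omega)] at e
      dsimp only at e
      rw [Fin.le_def, plumbing_empty_of_le hk]
      omega
  · intro h k
    constructor
    · have e := (h ⟨k, by omega⟩).1 k.2
      rw [Fin.le_def, plumbing_empty_of_lt k.2] at e
      dsimp only at e
      omega
    · have hk : n ≤ (Fin.rev (⟨k, by omega⟩ : Fin (2 * n)) : ℕ) := by
        simp only [Fin.val_rev]; omega
      have e := (h _).2 hk
      rw [Fin.le_def, plumbing_empty_of_le hk] at e
      have e' := Fin.val_rev (⟨k, by omega⟩ : Fin (2 * n))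
      dsimp only at e'
      omega

theorem isYoshi_iff_exists_plumbing {n : ℕ} {σ : Equiv.Perm (Fin (2 * n))} :
    IsYoshi σ ↔ ∃ X, plumbing X = σ := by
  have hl := isDescending_reverse_intersections n
  have hgr := (hl.gridLabels ∅).eq_of_cross (fun _ _ => not_gridElbow_empty)
  rw [isYoshi_iff_halfLE, plumbing_eq_run, (halfLE_run_empty_iff hl.nodup ?_).2 σ]
  · simp only [plumbing_eq_run]
  · rw [hl.forall_suffix (Φ := fun p l' =>
      run ∅ l' (avenueFaucet p) = lo p ∧ run ∅ l' (streetFaucet p) = hi p)]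
    intro p hp
    rw [List.mem_reverse, mem_intersections] at hp
    have hp' : (p.1 : ℕ) ≤ p.2 := hp
    rw [← label_eq_iff, ← label_eq_iff]
    exact ⟨(hl.label_lo ∅ p).trans ((hgr p.1).1 p.2 (by omega) p.2.2),
      (label_hi ∅ p).trans ((hgr p.1).2 p.1.2 _ (by omega) p.2.2)⟩

/-! ### The Bruhat order -/

section Bruhat

variable {m : ℕ}

theorem inv_swap_mul_or {i j : Fin m} (hij : (i : ℕ) + 1 = j) (σ : Equiv.Perm (Fin m)) :
    (σ.symm i < σ.symm j ∧ inv (Equiv.swap i j * σ) = inv σ + 1) ∨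
      inv (Equiv.swap i j * σ) + 1 = inv σ := by
  rcases lt_trichotomy (σ.symm i) (σ.symm j) with h | h | h
  · exact .inl ⟨h, inv_swap_mul hij h⟩
  · have := Fin.ext_iff.1 (σ.symm.injective h); omega
  · exact .inr (inv_swap_mul_of_gt hij h)

theorem IsSimpleWord.inv_prod_le {w : List (Equiv.Perm (Fin m))} (hw : IsSimpleWord w) :
    inv w.prod ≤ w.length := by
  induction w with
  | nil => simp [inv_one]
  | cons s w ih =>
    have := ih fun t ht => hw t (List.mem_cons_of_mem s ht)
    obtain ⟨i, j, hij, rfl⟩ := hw s List.mem_cons_self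
    rw [List.prod_cons, List.length_cons]
    rcases inv_swap_mul_or hij w.prod with h | h <;> omega

theorem IsSimpleWord.isReducedExpression {w : List (Equiv.Perm (Fin m))} (hw : IsSimpleWord w)
    (h : w.length = inv w.prod) : IsReducedExpression w w.prod :=
  ⟨hw, rfl, fun _ hw' e => h.trans_le (e ▸ hw'.inv_prod_le)⟩

/-- The permutation `σ` maps the first `I` elements among the first `J` ones. -/
def MapsInitial (I J : ℕ) (σ : Equiv.Perm (Fin m)) : Prop :=
  ∀ k : Fin m, (k : ℕ) < I → (σ k : ℕ) < J

/-- The condition `MapsInitial I J` is inherited by the subwords of a reduced word. Although each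
instance of the condition is one inequality of the tableau criterion, all instances have to be
carried along in the induction. -/
theorem MapsInitial.of_sublist {v w : List (Equiv.Perm (Fin m))} (hw : IsSimpleWord w)
    (hlen : w.length = inv w.prod) (hvw : v.Sublist w) (I J : ℕ)
    (h : MapsInitial I J w.prod) : MapsInitial I J v.prod := by
  have htail : ∀ {s : Equiv.Perm (Fin m)} {w : List (Equiv.Perm (Fin m))}, IsSimpleWord (s :: w) →
      (s :: w).length = inv (s :: w).prod → IsSimpleWord w ∧ w.length = inv w.prod ∧
      ∃ i j : Fin m, (i : ℕ) + 1 = j ∧ s = Equiv.swap i j ∧ w.prod.symm i < w.prod.symm j := by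
    intro s w hw hlen
    have hw' : IsSimpleWord w := fun t ht => hw t (List.mem_cons_of_mem s ht)
    have hle := hw'.inv_prod_le
    obtain ⟨i, j, hij, rfl⟩ := hw s List.mem_cons_self
    rw [List.prod_cons, List.length_cons] at hlen
    rcases inv_swap_mul_or hij w.prod with h | h
    · exact ⟨hw', by omega, i, j, hij, rfl, h.1⟩
    · omega
  have hdown : ∀ {i j : Fin m} {σ : Equiv.Perm (Fin m)} {J : ℕ}, (i : ℕ) + 1 = j →
      σ.symm i < σ.symm j → MapsInitial I J (Equiv.swap i j * σ) → MapsInitial I J σ := by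
    intro i j σ J hij hasc h k hk
    by_contra hJ
    have h1 := h k hk
    rw [Equiv.Perm.mul_apply] at h1
    have h2 : σ k = j ∧ (j : ℕ) = J := by
      simp only [Equiv.swap_apply_def, Fin.ext_iff] at h1 ⊢
      split_ifs at h1 <;> omega
    have h3 := h (σ.symm i) (by
      rw [← h2.1, Equiv.symm_apply_apply] at hasc
      exact lt_trans hasc hk)
    rw [Equiv.Perm.mul_apply, Equiv.apply_symm_apply, Equiv.swap_apply_left] at h3
    omega
  induction hvw generalizing J with
  | slnil => exact h
  | @cons v w s hvw ih =>
    obtain ⟨hw', hlen', i, j, hij, rfl, hasc⟩ := htail hw hlen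
    exact ih hw' hlen' J (hdown hij hasc (by rwa [List.prod_cons] at h))
  | @cons_cons v w s hvw ih =>
    obtain ⟨hw', hlen', i, j, hij, rfl, hasc⟩ := htail hw hlen
    rw [List.prod_cons] at h ⊢
    have hdw := hdown hij hasc h
    intro k hk
    rw [Equiv.Perm.mul_apply]
    by_cases hJ : J = j
    · -- No value of `w.prod` on the first `I` elements is `i`, so that the bound improves.
      have h1 : MapsInitial I i w.prod := by
        intro k hk
        have h2 := hdw k hk
        have h3 := h k hk
        rw [Equiv.Perm.mul_apply] at h3
        simp only [Equiv.swap_apply_def, Fin.ext_iff] at h3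
        split_ifs at h3 <;> omega
      have h2 := ih hw' hlen' i h1 k hk
      simp only [Equiv.swap_apply_def, Fin.ext_iff]
      split_ifs <;> omega
    · have h2 := ih hw' hlen' J hdw k hk
      simp only [Equiv.swap_apply_def, Fin.ext_iff]
      split_ifs <;> omega

theorem IsSimpleWord.reverse {w : List (Equiv.Perm (Fin m))} (hw : IsSimpleWord w) :
    IsSimpleWord w.reverse := fun s hs => hw s (List.mem_reverse.1 hs)

theorem IsSimpleWord.prod_reverse {w : List (Equiv.Perm (Fin m))} (hw : IsSimpleWord w) :
    w.reverse.prod = w.prod⁻¹ := by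
  rw [List.prod_inv_reverse]
  congr 2
  refine (List.map_id w).symm.trans (List.map_congr_left fun s hs => ?_)
  obtain ⟨i, j, -, rfl⟩ := hw s hs
  simp

end Bruhat

/-- The word of the crossings of a list of intersections. -/
def crossingWord {n : ℕ} (X : Finset (Fin n × Fin n)) (l : List (Fin n × Fin n)) :
    List (Equiv.Perm (Fin (2 * n))) :=
  (l.filter (· ∉ X)).map fun p => Equiv.swap (lo p) (hi p)

theorem isSimpleWord_crossingWord {n : ℕ} (X : Finset (Fin n × Fin n))
    (l : List (Fin n × Fin n)) : IsSimpleWord (crossingWord X l) := by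
  intro s hs
  obtain ⟨p, -, rfl⟩ := List.mem_map.1 hs
  exact ⟨lo p, hi p, lo_add_one p, rfl⟩

theorem prod_crossingWord {n : ℕ} (X : Finset (Fin n × Fin n)) (l : List (Fin n × Fin n)) :
    (crossingWord X l).prod = run X l := by
  induction l with
  | nil => rfl
  | cons p l ih =>
    rw [run_cons, ← ih, gate_def, crossingWord, crossingWord]
    by_cases hp : p ∈ X <;> simp [hp]

theorem length_crossingWord {n : ℕ} (X : Finset (Fin n × Fin n)) (l : List (Fin n × Fin n)) :
    (l.filter (· ∈ X)).length + (crossingWord X l).length = l.length := by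
  rw [crossingWord, List.length_map, List.length_eq_length_filter_add (l := l) (· ∈ X)]
  simp

theorem crossingWord_sublist {n : ℕ} (X : Finset (Fin n × Fin n)) (l : List (Fin n × Fin n)) :
    (crossingWord X l).Sublist (crossingWord ∅ l) := by
  refine List.Sublist.map _ ?_
  simp

theorem Distinguished.isReducedExpression {n : ℕ} {X : Finset (Fin n × Fin n)}
    {l : List (Fin n × Fin n)} (h : Distinguished X l) :
    IsReducedExpression (crossingWord X l) (run X l) := by
  have h1 := h.inv_run
  have h2 := length_crossingWord X l
  rw [← prod_crossingWord] at h1 ⊢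
  exact (isSimpleWord_crossingWord X l).isReducedExpression (by omega)

theorem distinguished_empty (n : ℕ) :
    Distinguished (∅ : Finset (Fin n × Fin n)) (intersections n).reverse :=
  (unionClosed_iff_distinguished.1 ⟨fun p hp => absurd hp (Finset.notMem_empty p),
    fun _ _ _ _ _ _ _ h => absurd h (Finset.notMem_empty _)⟩).2

/-- The crossings of the network without elbows are a word whose length is the number of inversions
of its product, so that this holds for every reduced expression. -/
theorem length_eq_inv_of_isReducedExpression_plumbing {n : ℕ}
    {w : List (Equiv.Perm (Fin (2 * n)))} (hw : IsReducedExpression w (plumbing ∅)) :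
    w.length = inv w.prod := by
  refine le_antisymm ?_ hw.1.inv_prod_le
  obtain ⟨h1, h2, -⟩ := (distinguished_empty n).isReducedExpression
  have h3 := (distinguished_empty n).inv_run
  have h4 := length_crossingWord ∅ (intersections n).reverse
  rw [← plumbing_eq_run] at h2 h3
  have h5 := hw.2.2 _ h1 h2
  rw [hw.2.1]
  omega

theorem BruhatLE.isYoshi {n : ℕ} {σ : Equiv.Perm (Fin (2 * n))}
    (h : BruhatLE σ (plumbing (∅ : Finset (Fin n × Fin n)))) : IsYoshi σ := by
  obtain ⟨v, w, ⟨hv, rfl, -⟩, hw, hvw⟩ := h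
  have hlen := length_eq_inv_of_isReducedExpression_plumbing hw
  rw [isYoshi_iff_halfLE]
  intro k
  constructor
  · intro hk
    have := MapsInitial.of_sublist hw.1 hlen hvw (k + 1) (2 * k + 2) (by
      intro x hx
      rw [hw.2.1, plumbing_empty_of_lt (by omega)]
      omega) k (Nat.lt_succ_self _)
    rw [Fin.le_def, plumbing_empty_of_lt hk]
    omega
  · intro hk
    -- The second half of the conditions is the first kind of condition, for the inverses.
    by_contra hlt
    rw [Fin.le_def, plumbing_empty_of_le hk, not_le] at hlt
    have hrev := hw.1.prod_reverse
    have := MapsInitial.of_sublist hw.1.reverse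
      (by rw [List.length_reverse, hlen, hrev, inv_inv]) (List.reverse_sublist.2 hvw)
      (2 * (k - n)) k (by
        intro x hx
        rw [hrev, hw.2.1]
        refine lt_of_not_ge fun hge => ?_
        have e := plumbing_empty_of_le (hk.trans hge)
        rw [Equiv.Perm.coe_inv, Equiv.apply_symm_apply] at e
        rw [Equiv.Perm.coe_inv] at hge
        omega) (v.prod k) hlt
    rw [hv.prod_reverse, Equiv.Perm.coe_inv, Equiv.symm_apply_apply] at this
    exact lt_irrefl _ this

/-! ### The bijections -/

theorem plumbing_filter_le {n : ℕ} (X : Finset (Fin n × Fin n)) :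
    plumbing (X.filter fun p => p.1 ≤ p.2) = plumbing X := by
  rw [plumbing_eq_run, plumbing_eq_run]
  refine run_congr fun p hp => ?_
  rw [List.mem_reverse, mem_intersections] at hp
  simp [hp]

theorem IsIntervalCollection.ext {n : ℕ} {X Y : Finset (Fin n × Fin n)}
    (hX : IsIntervalCollection X) (hY : IsIntervalCollection Y)
    (h : ∀ p ∈ intersections n, p ∈ X ↔ p ∈ Y) : X = Y := by
  ext p
  by_cases hp : p.1 ≤ p.2
  · exact h p (mem_intersections.2 hp)
  · exact ⟨fun h => absurd (hX p h) hp, fun h => absurd (hY p h) hp⟩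

theorem UnionClosed.card_add_inv {n : ℕ} {X : Finset (Fin n × Fin n)} (hX : UnionClosed X) :
    X.card + inv (plumbing X) = n * (n + 1) / 2 := by
  obtain ⟨h1, h2⟩ := unionClosed_iff_distinguished.1 hX
  have := h2.inv_run
  rwa [List.filter_reverse, List.length_reverse, List.length_reverse, h1.card_eq,
    length_intersections, ← plumbing_eq_run] at this

theorem UnionClosed.eq_of_plumbing_eq {n : ℕ} {X Y : Finset (Fin n × Fin n)}
    (hX : UnionClosed X) (hY : UnionClosed Y) (h : plumbing X = plumbing Y) : X = Y := by
  obtain ⟨hX1, hX2⟩ := unionClosed_iff_distinguished.1 hX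
  obtain ⟨hY1, hY2⟩ := unionClosed_iff_distinguished.1 hY
  rw [plumbing_eq_run, plumbing_eq_run] at h
  exact hX1.ext hY1 fun p hp => hX2.mem_iff_of_run_eq hY2 h p (List.mem_reverse.2 hp)

theorem IsYoshi.exists_unionClosed {n : ℕ} {σ : Equiv.Perm (Fin (2 * n))} (hσ : IsYoshi σ) :
    ∃ X, UnionClosed X ∧ plumbing X = σ := by
  obtain ⟨X, rfl⟩ := isYoshi_iff_exists_plumbing.1 hσ
  obtain ⟨Y, hY, hrun⟩ := exists_distinguished (isDescending_reverse_intersections n).nodup X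
  rw [← plumbing_eq_run, ← plumbing_eq_run] at hrun
  refine ⟨_, unionClosed_iff_distinguished.2 ⟨?_, hY.congr ?_⟩, (plumbing_filter_le Y).trans hrun⟩
  · exact fun p hp => (Finset.mem_filter.1 hp).2
  · intro p hp
    rw [List.mem_reverse, mem_intersections] at hp
    simp [hp]

theorem IntersectionClosed.card_add_inv {n : ℕ} {X : Finset (Fin n × Fin n)}
    (hX : IntersectionClosed X) : X.card + inv (plumbing X) = n * (n + 1) / 2 := by
  obtain ⟨h1, h2⟩ := intersectionClosed_iff_distinguished.1 hX
  have := h2.inv_run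
  rw [run_map_rot, inv_conj_rev, inv_inv, List.length_map, length_intersections, List.filter_map,
    List.length_map] at this
  rw [← this, ← h1.card_eq]
  congr 2
  refine List.filter_congr fun p _ => ?_
  simp only [Function.comp_apply, mem_image_rot, rot_rot]

theorem IntersectionClosed.eq_of_plumbing_eq {n : ℕ} {X Y : Finset (Fin n × Fin n)}
    (hX : IntersectionClosed X) (hY : IntersectionClosed Y) (h : plumbing X = plumbing Y) :
    X = Y := by
  obtain ⟨hX1, hX2⟩ := intersectionClosed_iff_distinguished.1 hX
  obtain ⟨hY1, hY2⟩ := intersectionClosed_iff_distinguished.1 hY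
  refine hX1.ext hY1 fun p hp => ?_
  have := hX2.mem_iff_of_run_eq hY2 (by rw [run_map_rot, run_map_rot, h]) (rot p)
    (List.mem_map_of_mem hp)
  rwa [mem_image_rot, mem_image_rot, rot_rot] at this

theorem IsYoshi.exists_intersectionClosed {n : ℕ} {σ : Equiv.Perm (Fin (2 * n))}
    (hσ : IsYoshi σ) : ∃ X, IntersectionClosed X ∧ plumbing X = σ := by
  obtain ⟨X, rfl⟩ := isYoshi_iff_exists_plumbing.1 hσ
  obtain ⟨Y', hY, hrun⟩ := exists_distinguished (isDescending_map_rot n).nodup (X.image rot)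
  obtain ⟨Y, rfl⟩ : ∃ Y : Finset (Fin n × Fin n), Y' = Y.image rot :=
    ⟨Y'.image rot, by ext; rw [mem_image_rot, mem_image_rot, rot_rot]⟩
  rw [run_map_rot, run_map_rot, mul_left_inj, mul_right_inj, inv_inj] at hrun
  refine ⟨_, intersectionClosed_iff_distinguished.2 ⟨?_, hY.congr ?_⟩,
    (plumbing_filter_le Y).trans hrun⟩
  · exact fun p hp => (Finset.mem_filter.1 hp).2
  · intro p hp
    rw [mem_map_rot] at hp
    rw [mem_image_rot, mem_image_rot]
    simp [rot, hp]

theorem IsYoshi.bruhatLE {n : ℕ} {σ : Equiv.Perm (Fin (2 * n))} (hσ : IsYoshi σ) :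
    BruhatLE σ (plumbing (∅ : Finset (Fin n × Fin n))) := by
  obtain ⟨X, hX, rfl⟩ := hσ.exists_unionClosed
  rw [plumbing_eq_run, plumbing_eq_run]
  exact ⟨_, _, (unionClosed_iff_distinguished.1 hX).2.isReducedExpression,
    (distinguished_empty n).isReducedExpression, crossingWord_sublist X _⟩

end YoshiHill

theorem mainTheorem2 (n : ℕ) :
    ∃ (f : {X : Finset (Fin n × Fin n) // YoshiHill.IntersectionClosed X} ≃
          {σ : Equiv.Perm (Fin (2 * n)) // YoshiHill.IsYoshi σ})
      (g : {X : Finset (Fin n × Fin n) // YoshiHill.UnionClosed X} ≃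
          {σ : Equiv.Perm (Fin (2 * n)) // YoshiHill.IsYoshi σ})
      (h : {X : Finset (Fin n × Fin n) // YoshiHill.IntersectionClosed X} ≃
          {X : Finset (Fin n × Fin n) // YoshiHill.UnionClosed X}),
      (∀ X, (f X).1 = YoshiHill.plumbing X.1) ∧
      (∀ Y, (g Y).1 = YoshiHill.plumbing Y.1) ∧
      (∀ X, g (h X) = f X) ∧
      (∀ X, X.1.card + YoshiHill.inv (f X).1 = n * (n + 1) / 2) ∧
      (∀ Y, Y.1.card + YoshiHill.inv (g Y).1 = n * (n + 1) / 2) ∧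
      (∀ X, (h X).1.card = X.1.card) ∧
      (∀ σ : Equiv.Perm (Fin (2 * n)),
        YoshiHill.IsYoshi σ ↔
          YoshiHill.BruhatLE σ (YoshiHill.plumbing (∅ : Finset (Fin n × Fin n)))) := by
  let f : {X : Finset (Fin n × Fin n) // YoshiHill.IntersectionClosed X} ≃
      {σ : Equiv.Perm (Fin (2 * n)) // YoshiHill.IsYoshi σ} :=
    Equiv.ofBijective
      (fun X => ⟨YoshiHill.plumbing X.1, YoshiHill.isYoshi_iff_exists_plumbing.2 ⟨X.1, rfl⟩⟩)
      ⟨fun X Y h => Subtype.ext (X.2.eq_of_plumbing_eq Y.2 (congrArg Subtype.val h)),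
        fun σ => by
          obtain ⟨X, hX, h⟩ := σ.2.exists_intersectionClosed
          exact ⟨⟨X, hX⟩, Subtype.ext h⟩⟩
  let g : {X : Finset (Fin n × Fin n) // YoshiHill.UnionClosed X} ≃
      {σ : Equiv.Perm (Fin (2 * n)) // YoshiHill.IsYoshi σ} :=
    Equiv.ofBijective
      (fun X => ⟨YoshiHill.plumbing X.1, YoshiHill.isYoshi_iff_exists_plumbing.2 ⟨X.1, rfl⟩⟩)
      ⟨fun X Y h => Subtype.ext (X.2.eq_of_plumbing_eq Y.2 (congrArg Subtype.val h)),
        fun σ => by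
          obtain ⟨X, hX, h⟩ := σ.2.exists_unionClosed
          exact ⟨⟨X, hX⟩, Subtype.ext h⟩⟩
  have hgh : ∀ X, g (g.symm (f X)) = f X := fun X => g.apply_symm_apply (f X)
  have hf : ∀ X, X.1.card + YoshiHill.inv (f X).1 = n * (n + 1) / 2 := fun X => X.2.card_add_inv
  have hg : ∀ Y, Y.1.card + YoshiHill.inv (g Y).1 = n * (n + 1) / 2 := fun Y => Y.2.card_add_inv
  refine ⟨f, g, f.trans g.symm, fun X => rfl, fun Y => rfl, hgh, hf, hg, fun X => ?_,
    fun σ => ⟨fun h => h.bruhatLE, fun h => h.isYoshi⟩⟩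
  have h1 := hg (g.symm (f X))
  rw [hgh, ← hf X] at h1
  exact Nat.add_right_cancel h1
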